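/- Let $k$ be a field and let $\mathcal E$ be a $k$-linear Frobenius category with split idempotents (a Quillen exact category with enough projectives and enough injectives in which projectives and injectives coincide). Let $\mathcal C=\underline{\mathcal E}$ be its stable category, i.e. the quotient of $\mathcal E$ by the ideal of the morphisms that factor through a projective, with suspension functor $S$ given by conflations $0\to X\to I\to SX\to 0$ with $I$ injective. Suppose that all morphism spaces of $\mathcal C$ are finite-dimensional over $k$ and that $\mathcal C$ is Calabi-Yau of dimension $2$, i.e. there are $k$-linear isomorphisms $D\,\mathcal C(X,Y)\cong\mathcal C(Y,S^2X)$ natural in $X,Y\in\mathcal C$, where $D=\operatorname{Hom}_k(?,k)$. Let $\mathcal T\subset\mathcal C$ be a cluster tilting subcategory, i.e. a full subcategory such that every object $X$ of $\mathcal C$ admits a right $\mathcal T$-approximation (a morphism $T\to X$ with $T\in\mathcal T$ through which every morphism $T'\to X$ with $T'\in\mathcal T$ factors), $\mathcal C(T,ST')=0$ for all $T,T'\in\mathcal T$, and every $X$ with $\mathcal C(T,SX)=0$ for all $T\in\mathcal T$ lies in $\mathcal T$. Let $\mathcal M\subset\mathcal E$ be the full subcategory of the objects whose image in $\mathcal C$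 lies in $\mathcal T$, and let $\underline{\mathcal M}=\mathcal T$ be its image. An $\mathcal M$-module is a $k$-linear functor from $\mathcal M^{op}$ to $k$-vector spaces; $M^\wedge=\mathcal M(?,M)$ is the module represented by $M\in\mathcal M$; a module is finitely presented if it is the cokernel of a morphism between representable modules; similarly for $\underline{\mathcal M}$. Every $\underline{\mathcal M}$-module is regarded as an $\mathcal M$-module along the projection $\mathcal M\to\underline{\mathcal M}$. Let $\operatorname{per}(\mathcal M)$ be the full triangulated subcategory of the derived category of the category of all $\mathcal M$-modules that is generated by the finitely generated projective $\mathcal M$-modules. Then the following hold. (a) For each $X\in\mathcal E$ there is a conflation $0\to M_1\to M_0\to X\to 0$ with $M_0,M_1\in\mathcal M$. In any such conflation, $M_0\to X$ is a right $\mathcal M$-approximation. (b) Let $Z$ be a finitely presented $\mathcal M$-module. Then $Z$ vanishes on all projective objects of $\mathcal E$ if and only if there is a conflation $0\to K\to M_1\to M_0\to 0$ with $M_0,M_1\in\mathcal M$ such that $Z\cong\operatorname{cok}(M_1^\wedge\to M_0^\wedge)$. For every such conflation, $Z\cong\operatorname{Ext}^1_{\mathcal E}(?,K)|_{\mathcal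 M}$ as $\mathcal M$-modules. (c) Let $Z$ be a finitely presented $\underline{\mathcal M}$-module. Then $Z$, considered as an $\mathcal M$-module (in degree $0$), lies in $\operatorname{per}(\mathcal M)$, and there are $k$-linear isomorphisms $$D\operatorname{per}(\mathcal M)(Z,Y)\;\cong\;\operatorname{per}(\mathcal M)(Y,Z[3])$$ natural in $Y\in\operatorname{per}(\mathcal M)$ and in the finitely presented $\underline{\mathcal M}$-module $Z$. -/

import Mathlib

open CategoryTheory CategoryTheory.Limits

set_option linter.unusedSectionVars false

universe w v u t

/-! ### Exact categories and Frobenius categories -/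

section Exact

variable {E : Type u} [Category.{v} E] [Preadditive E]

/-- The first morphisms of the short complexes in a given class. -/
def IsInflationOf (c : ObjectProperty (ShortComplex E)) {A B : E} (i : A ⟶ B) : Prop :=
  ∃ (D : E) (p : B ⟶ D) (h : i ≫ p = 0), c (ShortComplex.mk i p h)

/-- The second morphisms of the short complexes in a given class. -/
def IsDeflationOf (c : ObjectProperty (ShortComplex E)) {B D : E} (p : B ⟶ D) : Prop :=
  ∃ (A : E) (i : A ⟶ B) (h : i ≫ p = 0), c (ShortComplex.mk i p h)

variable (E) in
/-- A Quillen exact structure on an additive category: a class of kernel-cokernel pairs, called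
conflations, that is closed under isomorphism and satisfies Quillen's axioms. -/
structure ExactStructure where
  /-- the class of conflations `A ⟶ B ⟶ D` -/
  conflation : ObjectProperty (ShortComplex E)
  of_iso : ∀ {S S' : ShortComplex E}, (S ≅ S') → conflation S → conflation S'
  isKernel : ∀ S : ShortComplex E, conflation S →
    Nonempty (IsLimit (KernelFork.ofι S.f S.zero))
  isCokernel : ∀ S : ShortComplex E, conflation S →
    Nonempty (IsColimit (CokernelCofork.ofπ S.g S.zero))
  id_inflation : ∀ X : E, IsInflationOf conflation (𝟙 X)
  id_deflation : ∀ X : E, IsDeflationOf conflation (𝟙 X)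
  comp_inflation : ∀ {A B D : E} (i : A ⟶ B) (j : B ⟶ D),
    IsInflationOf conflation i → IsInflationOf conflation j → IsInflationOf conflation (i ≫ j)
  comp_deflation : ∀ {A B D : E} (p : A ⟶ B) (q : B ⟶ D),
    IsDeflationOf conflation p → IsDeflationOf conflation q → IsDeflationOf conflation (p ≫ q)
  pushout_inflation : ∀ {A B A' : E} (i : A ⟶ B) (f : A ⟶ A'), IsInflationOf conflation i →
    ∃ (B' : E) (f' : B ⟶ B') (i' : A' ⟶ B'), IsPushout i f f' i' ∧ IsInflationOf conflation i'
  pullback_deflation : ∀ {B D D' : E} (p : B ⟶ D) (f : D' ⟶ D), IsDeflationOf conflation p →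
    ∃ (B' : E) (f' : B' ⟶ B) (p' : B' ⟶ D'), IsPullback f' p' p f ∧ IsDeflationOf conflation p'

namespace ExactStructure

variable (𝓔 : ExactStructure E)

/-- `A ⟶ B ⟶ D` is a conflation `0 ⟶ A ⟶ B ⟶ D ⟶ 0`. -/
def IsConflation {A B D : E} (i : A ⟶ B) (p : B ⟶ D) : Prop :=
  ∃ h : i ≫ p = 0, 𝓔.conflation (ShortComplex.mk i p h)

/-- Projective objects relative to the exact structure. -/
def IsProjective (P : E) : Prop :=
  ∀ ⦃A B D : E⦄ (i : A ⟶ B) (p : B ⟶ D), 𝓔.IsConflation i p →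
    ∀ f : P ⟶ D, ∃ g : P ⟶ B, g ≫ p = f

/-- Injective objects relative to the exact structure. -/
def IsInjective (I : E) : Prop :=
  ∀ ⦃A B D : E⦄ (i : A ⟶ B) (p : B ⟶ D), 𝓔.IsConflation i p →
    ∀ f : A ⟶ I, ∃ g : B ⟶ I, i ≫ g = f

/-- A Frobenius category: enough projectives, enough injectives, and the projectives are
the injectives. -/
class IsFrobenius : Prop where
  enough_projectives : ∀ X : E, ∃ (K P : E) (i : K ⟶ P) (p : P ⟶ X),
    𝓔.IsProjective P ∧ 𝓔.IsConflation i p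
  enough_injectives : ∀ X : E, ∃ (I D : E) (i : X ⟶ I) (p : I ⟶ D),
    𝓔.IsInjective I ∧ 𝓔.IsConflation i p
  projective_iff_injective : ∀ X : E, 𝓔.IsProjective X ↔ 𝓔.IsInjective X

variable {𝓔} in
lemma IsConflation.exists_lift {A B D : E} {i : A ⟶ B} {p : B ⟶ D} (h : 𝓔.IsConflation i p)
    {X : E} (f : B ⟶ X) (hf : i ≫ f = 0) : ∃ g : D ⟶ X, p ≫ g = f := by
  obtain ⟨h0, hc⟩ := h
  obtain ⟨hl⟩ := 𝓔.isCokernel _ hc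
  exact ⟨hl.desc (CokernelCofork.ofπ f hf), hl.fac _ WalkingParallelPair.one⟩

variable {𝓔} in
lemma IsConflation.epi {A B D : E} {i : A ⟶ B} {p : B ⟶ D} (h : 𝓔.IsConflation i p) : Epi p := by
  obtain ⟨h0, hc⟩ := h
  obtain ⟨hl⟩ := 𝓔.isCokernel _ hc
  exact ⟨fun a b hab => Cofork.IsColimit.hom_ext hl hab⟩

/-! ### Chosen injective conflations in a Frobenius category -/

noncomputable section Hull

variable [h𝓔 : 𝓔.IsFrobenius]

/-- The injective object in a chosen conflation `0 ⟶ X ⟶ I X ⟶ S X ⟶ 0`. -/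
def hull (X : E) : E := (h𝓔.enough_injectives X).choose

/-- The cokernel in the chosen conflation `0 ⟶ X ⟶ I X ⟶ S X ⟶ 0`. -/
def cosyzygy (X : E) : E := (h𝓔.enough_injectives X).choose_spec.choose

/-- The inflation `X ⟶ I X`. -/
def toHull (X : E) : X ⟶ 𝓔.hull X := (h𝓔.enough_injectives X).choose_spec.choose_spec.choose

/-- The deflation `I X ⟶ S X`. -/
def fromHull (X : E) : 𝓔.hull X ⟶ 𝓔.cosyzygy X :=
  (h𝓔.enough_injectives X).choose_spec.choose_spec.choose_spec.choose

lemma hull_injective (X : E) : 𝓔.IsInjective (𝓔.hull X) :=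
  (h𝓔.enough_injectives X).choose_spec.choose_spec.choose_spec.choose_spec.1

lemma hull_conflation (X : E) : 𝓔.IsConflation (𝓔.toHull X) (𝓔.fromHull X) :=
  (h𝓔.enough_injectives X).choose_spec.choose_spec.choose_spec.choose_spec.2

/-- `h : S X ⟶ S Y` fits into a morphism of the chosen conflations that starts with `f`. -/
def IsCosyzygyMap {X Y : E} (f : X ⟶ Y) (h : 𝓔.cosyzygy X ⟶ 𝓔.cosyzygy Y) : Prop :=
  ∃ g : 𝓔.hull X ⟶ 𝓔.hull Y,
    𝓔.toHull X ≫ g = f ≫ 𝓔.toHull Y ∧ 𝓔.fromHull X ≫ h = g ≫ 𝓔.fromHull Y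

lemma exists_isCosyzygyMap {X Y : E} (f : X ⟶ Y) : ∃ h, 𝓔.IsCosyzygyMap f h := by
  obtain ⟨g, hg⟩ := 𝓔.hull_injective Y _ _ (𝓔.hull_conflation X) (f ≫ 𝓔.toHull Y)
  obtain ⟨h, hh⟩ := (𝓔.hull_conflation X).exists_lift (g ≫ 𝓔.fromHull Y) (by
    rw [← Category.assoc, hg, Category.assoc, (𝓔.hull_conflation Y).1, comp_zero])
  exact ⟨h, g, hg, hh⟩

end Hull

/-! ### The stable category -/

/-- `f` factors through a projective object. -/
def FactorsThroughProjective {X Y : E} (f : X ⟶ Y) : Prop :=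
  ∃ (P : E) (a : X ⟶ P) (b : P ⟶ Y), 𝓔.IsProjective P ∧ a ≫ b = f

/-- Two morphisms are stably equal if their difference factors through a projective object. -/
def stableRel : HomRel E := fun _ _ f g => 𝓔.FactorsThroughProjective (f - g)

variable {𝓔} in
lemma FactorsThroughProjective.comp_left {X Y Z : E} (a : X ⟶ Y) {f : Y ⟶ Z}
    (h : 𝓔.FactorsThroughProjective f) : 𝓔.FactorsThroughProjective (a ≫ f) := by
  obtain ⟨P, b, c, hP, rfl⟩ := h
  exact ⟨P, a ≫ b, c, hP, by simp⟩

variable {𝓔} in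
lemma FactorsThroughProjective.comp_right {X Y Z : E} {f : X ⟶ Y} (a : Y ⟶ Z)
    (h : 𝓔.FactorsThroughProjective f) : 𝓔.FactorsThroughProjective (f ≫ a) := by
  obtain ⟨P, b, c, hP, rfl⟩ := h
  exact ⟨P, b, c ≫ a, hP, by simp⟩

variable {𝓔} in
lemma FactorsThroughProjective.neg {X Y : E} {f : X ⟶ Y}
    (hf : 𝓔.FactorsThroughProjective f) : 𝓔.FactorsThroughProjective (-f) := by
  obtain ⟨P, a, b, hP, rfl⟩ := hf
  exact ⟨P, -a, b, hP, by simp⟩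

variable [HasFiniteBiproducts E]

variable {𝓔} in
lemma FactorsThroughProjective.add {X Y : E} {f g : X ⟶ Y}
    (hf : 𝓔.FactorsThroughProjective f) (hg : 𝓔.FactorsThroughProjective g) :
    𝓔.FactorsThroughProjective (f + g) := by
  obtain ⟨P, a, b, hP, rfl⟩ := hf
  obtain ⟨Q, c, d, hQ, rfl⟩ := hg
  have := hasBinaryBiproducts_of_finite_biproducts E
  refine ⟨P ⊞ Q, biprod.lift a c, biprod.desc b d, ?_, by simp⟩
  intro A B D i p h f
  obtain ⟨g₁, h₁⟩ := hP i p h (biprod.inl ≫ f)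
  obtain ⟨g₂, h₂⟩ := hQ i p h (biprod.inr ≫ f)
  refine ⟨biprod.desc g₁ g₂, ?_⟩
  ext <;> simp [h₁, h₂]

lemma factorsThroughProjective_zero (X Y : E) :
    𝓔.FactorsThroughProjective (0 : X ⟶ Y) := by
  refine ⟨⨁ (fun e : PEmpty.{1} => (e.elim : E)), 0, 0, ?_, by simp⟩
  intro A B D i p h f
  exact ⟨0, by ext e; exact e.elim⟩

instance : Congruence 𝓔.stableRel where
  comp_left a _ _ h := by
    have := FactorsThroughProjective.comp_left a h
    rwa [Preadditive.comp_sub] at this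
  comp_right a h := by
    have := FactorsThroughProjective.comp_right a h
    rwa [Preadditive.sub_comp] at this
  equivalence :=
    { refl := fun f => by
        simpa [stableRel] using 𝓔.factorsThroughProjective_zero _ _
      symm := fun {f g} h => by
        have := FactorsThroughProjective.neg h
        rwa [neg_sub] at this
      trans := fun {f g l} h h' => by
        have := FactorsThroughProjective.add h h'
        rwa [sub_add_sub_cancel] at this }

/-- The stable category: the quotient of `E` by the ideal of the morphisms that factor through
a projective object. -/
abbrev StableCategory := CategoryTheory.Quotient 𝓔.stableRel

/-- The projection functor onto the stable category. -/
abbrev toStable : E ⥤ 𝓔.StableCategory := CategoryTheory.Quotient.functor 𝓔.stableRel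

instance : Preadditive 𝓔.StableCategory :=
  CategoryTheory.Quotient.preadditive 𝓔.stableRel (fun X Y f₁ f₂ g₁ g₂ h h' => by
    have := FactorsThroughProjective.add h h'
    rwa [sub_add_sub_comm] at this)

instance : 𝓔.toStable.Additive where
  map_add := rfl

variable (k : Type t) [Field k] [Linear k E]

instance : Linear k 𝓔.StableCategory :=
  CategoryTheory.Quotient.linear k 𝓔.stableRel (fun a X Y f g h => by
    obtain ⟨P, b, c, hP, h⟩ := h
    exact ⟨P, a • b, c, hP, by rw [Linear.smul_comp, h, smul_sub]⟩)

instance : 𝓔.toStable.Linear k where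
  map_smul _ _ := rfl

/-! ### The suspension functor of the stable category of a Frobenius category -/

noncomputable section

variable [h𝓔 : 𝓔.IsFrobenius]

lemma IsCosyzygyMap.stable_eq {X Y : E} {f f' : X ⟶ Y} {h h' : 𝓔.cosyzygy X ⟶ 𝓔.cosyzygy Y}
    (H : 𝓔.IsCosyzygyMap f h) (H' : 𝓔.IsCosyzygyMap f' h') (hf : 𝓔.stableRel f f') :
    𝓔.toStable.map h = 𝓔.toStable.map h' := by
  obtain ⟨g, h₁, h₂⟩ := H
  obtain ⟨g', h₁', h₂'⟩ := H'
  obtain ⟨P, a, b, hP, hab⟩ := hf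
  obtain ⟨a', ha'⟩ := (h𝓔.projective_iff_injective P).1 hP _ _ (𝓔.hull_conflation X) a
  obtain ⟨c, hc⟩ := (𝓔.hull_conflation X).exists_lift (g - g' - a' ≫ b ≫ 𝓔.toHull Y) (by
    rw [Preadditive.comp_sub, Preadditive.comp_sub, h₁, h₁', ← Category.assoc _ a', ha',
      ← Category.assoc, hab, Preadditive.sub_comp, sub_self])
  refine CategoryTheory.Quotient.sound _ ⟨𝓔.hull Y, c, 𝓔.fromHull Y,
    (h𝓔.projective_iff_injective _).2 (𝓔.hull_injective Y), ?_⟩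
  have := (𝓔.hull_conflation X).epi
  rw [← cancel_epi (𝓔.fromHull X), ← Category.assoc, hc, Preadditive.comp_sub, h₂, h₂']
  simp [(𝓔.hull_conflation Y).1]

/-- The suspension functor `S` of the stable category: it sends `X` to the cokernel in the chosen
conflation `0 ⟶ X ⟶ I X ⟶ S X ⟶ 0`, and the class of a morphism `f : X ⟶ Y` to the class of
any morphism `S X ⟶ S Y` induced by an extension of `f` to a morphism `I X ⟶ I Y`. -/
def suspension : 𝓔.StableCategory ⥤ 𝓔.StableCategory :=
  CategoryTheory.Quotient.lift 𝓔.stableRel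
    { obj := fun X => 𝓔.toStable.obj (𝓔.cosyzygy X)
      map := fun f => 𝓔.toStable.map (𝓔.exists_isCosyzygyMap f).choose
      map_id := fun X => by
        rw [← 𝓔.toStable.map_id]
        exact IsCosyzygyMap.stable_eq 𝓔 (𝓔.exists_isCosyzygyMap (𝟙 X)).choose_spec
          ⟨𝟙 _, by simp, by simp⟩ (Congruence.equivalence.refl _)
      map_comp := fun {X Y Z} f f' => by
        rw [← 𝓔.toStable.map_comp]
        obtain ⟨g, h₁, h₂⟩ := (𝓔.exists_isCosyzygyMap f).choose_spec
        obtain ⟨g', h₁', h₂'⟩ := (𝓔.exists_isCosyzygyMap f').choose_spec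
        refine IsCosyzygyMap.stable_eq 𝓔 (𝓔.exists_isCosyzygyMap (f ≫ f')).choose_spec
          ⟨g ≫ g', ?_, ?_⟩ (Congruence.equivalence.refl _)
        · rw [← Category.assoc, h₁, Category.assoc, h₁', Category.assoc]
        · rw [← Category.assoc, h₂, Category.assoc, h₂', Category.assoc] }
    (fun X Y f f' h => IsCosyzygyMap.stable_eq 𝓔 (𝓔.exists_isCosyzygyMap f).choose_spec
      (𝓔.exists_isCosyzygyMap f').choose_spec h)

/-- The functor `Ext¹(?, K)` on `E`, computed as a right derived functor by means of the
injective conflation `0 ⟶ K ⟶ I K ⟶ S K ⟶ 0`: it is the cokernel of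
`Hom(?, I K) ⟶ Hom(?, S K)`. -/
def ext1 (K : E) : Eᵒᵖ ⥤ ModuleCat.{v} k :=
  cokernel ((linearYoneda k E).map (𝓔.fromHull K))

end

end ExactStructure

end Exact

/-! ### Duality and cluster tilting subcategories -/

/-- For functors `F G : A ⥤ C` to a `k`-linear category, `k`-linear isomorphisms
`Hom(Y, G Z) ≅ D Hom(F Z, Y)` that are natural in `Z : A` and in `Y : C`, where `D` is the
duality over `k`. -/
structure NaturalDuality (k : Type t) [Field k] {A : Type*} [Category* A] {C : Type*} [Category* C]
    [Preadditive C] [Linear k C] (F G : A ⥤ C) where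
  /-- the isomorphisms -/
  iso : ∀ (Z : A) (Y : C), (Y ⟶ G.obj Z) ≃ₗ[k] Module.Dual k (F.obj Z ⟶ Y)
  naturality_right : ∀ (Z : A) {Y Y' : C} (y : Y ⟶ Y') (b : Y' ⟶ G.obj Z) (a : F.obj Z ⟶ Y),
    iso Z Y (y ≫ b) a = iso Z Y' b (a ≫ y)
  naturality_left : ∀ {Z Z' : A} (z : Z ⟶ Z') (Y : C) (b : Y ⟶ G.obj Z) (a : F.obj Z' ⟶ Y),
    iso Z' Y (b ≫ G.map z) a = iso Z Y b (F.map z ≫ a)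

/-- A `k`-linear category `C` with suspension functor `S` is Calabi-Yau of dimension `2`:
`D Hom(X, Y) ≅ Hom(Y, S² X)`, naturally in `X` and `Y`; in other words, `S²` is
a Serre functor. -/
def IsTwoCalabiYau (k : Type t) [Field k] {C : Type*} [Category* C]
    [Preadditive C] [Linear k C] (S : C ⥤ C) : Prop :=
  Nonempty (NaturalDuality k (𝟭 C) (S ⋙ S))

/-- `f : T₀ ⟶ X` is a right `T`-approximation: `T₀` is in `T`, and each morphism from an object
of `T` to `X` factors through `f`. -/
def IsRightApproximation {C : Type*} [Category* C] (T : ObjectProperty C) {T₀ X : C}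
    (f : T₀ ⟶ X) : Prop :=
  T T₀ ∧ ∀ (T' : C) (g : T' ⟶ X), T T' → ∃ l : T' ⟶ T₀, l ≫ f = g

/-- The full subcategory `T` of `C` is cluster tilting, where `Ext¹(X, Y) = Hom(X, S Y)`. -/
structure IsClusterTilting {C : Type*} [Category* C] [Preadditive C] (S : C ⥤ C)
    (T : ObjectProperty C) : Prop where
  contravariantly_finite : ∀ X : C, ∃ (T₀ : C) (f : T₀ ⟶ X), IsRightApproximation T f
  rigid : ∀ T₁ T₂ : C, T T₁ → T T₂ → ∀ f : T₁ ⟶ S.obj T₂, f = 0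
  maximal : ∀ X : C, (∀ T₁ : C, T T₁ → ∀ f : T₁ ⟶ S.obj X, f = 0) → T X

/-! ### Modules over linear categories -/

noncomputable section Modules

variable (k : Type t) [Field k]

section

variable (A : Type u) [Category.{v} A] [Preadditive A] [Linear k A]

/-- The `k`-linear functors among all functors from `Aᵒᵖ` to vector spaces. -/
def isLinearFunctor : ObjectProperty (Aᵒᵖ ⥤ ModuleCat.{v} k) := fun F =>
  (∀ (X Y : A) (f g : X ⟶ Y), F.map (f + g).op = F.map f.op + F.map g.op) ∧
    ∀ (X Y : A) (f : X ⟶ Y) (r : k), F.map (r • f).op = r • F.map f.op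

instance : (isLinearFunctor k A).IsClosedUnderSubobjects where
  prop_of_mono {F G} i _ h := by
    have (X : Aᵒᵖ) : Mono (i.app X) := inferInstance
    refine ⟨fun X Y f g => ?_, fun X Y f r => ?_⟩
    · rw [← cancel_mono (i.app _)]
      simp only [Preadditive.add_comp, NatTrans.naturality, h.1, Preadditive.comp_add]
    · rw [← cancel_mono (i.app _)]
      simp only [Linear.smul_comp, NatTrans.naturality, h.2, Linear.comp_smul]

instance : (isLinearFunctor k A).IsClosedUnderQuotients where
  prop_of_epi {F G} i _ h := by
    have (X : Aᵒᵖ) : Epi (i.app X) := inferInstance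
    refine ⟨fun X Y f g => ?_, fun X Y f r => ?_⟩
    · rw [← cancel_epi (i.app _)]
      simp only [Preadditive.comp_add, ← NatTrans.naturality, h.1, Preadditive.add_comp]
    · rw [← cancel_epi (i.app _)]
      simp only [Linear.comp_smul, ← NatTrans.naturality, h.2, Linear.smul_comp]

instance : (isLinearFunctor k A).ContainsZero where
  exists_zero := by
    have h : IsZero (ModuleCat.of k PUnit.{v + 1}) := ModuleCat.isZero_of_subsingleton _
    exact ⟨(Functor.const Aᵒᵖ).obj _, Functor.isZero _ fun _ => h,
      fun _ _ _ _ => h.eq_of_src _ _, fun _ _ _ _ => h.eq_of_src _ _⟩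

instance : (isLinearFunctor k A).IsClosedUnderFiniteProducts where
  isClosedUnderLimitsOfShape J _ :=
    { limitsOfShape_le := by
        rintro F ⟨h⟩
        refine ⟨fun X Y f g => ?_, fun X Y f r => ?_⟩
        · refine (isLimitOfPreserves ((evaluation _ _).obj (Opposite.op X)) h.isLimit).hom_ext
            fun j => ?_
          have hj := (h.prop_diag_obj j).1 X Y f g
          simp only [Functor.mapCone_π_app, evaluation_obj_map, Preadditive.add_comp,
            NatTrans.naturality, hj, Preadditive.comp_add]
        · refine (isLimitOfPreserves ((evaluation _ _).obj (Opposite.op X)) h.isLimit).hom_ext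
            fun j => ?_
          have hj := (h.prop_diag_obj j).2 X Y f r
          simp only [Functor.mapCone_π_app, evaluation_obj_map, Linear.smul_comp,
            NatTrans.naturality, hj, Linear.comp_smul] }

/-- The category of (right) `A`-modules: the contravariant `k`-linear functors from `A` to
`k`-vector spaces. -/
abbrev LinMod := (isLinearFunctor k A).FullSubcategory

variable {A} in
/-- The representable module `M^ = A(?, M)`, as a functor of `M`. -/
def LinMod.yoneda : A ⥤ LinMod k A :=
  (isLinearFunctor k A).lift (linearYoneda k A) (fun M =>
    ⟨fun X Y f g => by ext a; exact Preadditive.add_comp _ _ _ f g a,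
      fun X Y f r => by ext a; exact Linear.smul_comp _ _ _ r f a⟩)

variable {k} {A} in
/-- Finitely generated modules over an additive category: the quotients of representable
modules. -/
def LinMod.IsFinitelyGenerated (Z : LinMod k A) : Prop :=
  ∃ (M : A) (p : (LinMod.yoneda k).obj M ⟶ Z), Epi p

/-- Finitely presented modules over an additive category: the cokernels of morphisms between
representable modules. -/
def LinMod.isFinitelyPresented : ObjectProperty (LinMod k A) := fun Z =>
  ∃ (M₁ M₀ : A) (f : M₁ ⟶ M₀), Nonempty (Z ≅ cokernel ((LinMod.yoneda k).map f))

variable {A}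
variable {B : Type u} [Category.{v} B] [Preadditive B] [Linear k B]

/-- Restriction of modules along a `k`-linear functor. -/
def LinMod.restrict (F : A ⥤ B) [F.Additive] [F.Linear k] : LinMod k B ⥤ LinMod k A :=
  (isLinearFunctor k A).lift
    ((isLinearFunctor k B).ι ⋙ (Functor.whiskeringLeft _ _ (ModuleCat.{v} k)).obj F.op)
    (fun Z => ⟨fun X Y f g => by simpa using Z.property.1 _ _ (F.map f) (F.map g),
      fun X Y f r => by simpa using Z.property.2 _ _ (F.map f) r⟩)

end

/-! ### The perfect derived category -/

section

variable {D : Type*} [Category* D] [HasZeroObject D] [HasShift D ℤ] [Preadditive D]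
  [∀ n : ℤ, (shiftFunctor D n).Additive] [Pretriangulated D]

/-- The triangulated subcategory generated by `P`: the smallest strictly full triangulated
subcategory that contains `P`. -/
def triangulatedHull (P : ObjectProperty D) : ObjectProperty D := fun X =>
  ∀ Q : ObjectProperty D, Q.IsTriangulated → Q.IsClosedUnderIsomorphisms → P ≤ Q → Q X

instance (P : ObjectProperty D) : (triangulatedHull P).IsClosedUnderIsomorphisms where
  of_iso e hX Q h₁ h₂ h₃ := Q.prop_of_iso e (hX Q h₁ h₂ h₃)

open ZeroObject in
instance (P : ObjectProperty D) : (triangulatedHull P).IsTriangulated where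
  exists_zero := ⟨0, isZero_zero D, fun Q _ _ _ => Q.prop_zero⟩
  isStableUnderShiftBy n :=
    { le_shift := fun _ hX Q h₁ h₂ h₃ => Q.le_shift n _ (hX Q h₁ h₂ h₃) }
  toIsTriangulatedClosed₂ := .mk' (fun T hT h₁ h₃ Q hQ₁ hQ₂ hQ₃ =>
    Q.ext_of_isTriangulatedClosed₂ T hT (h₁ Q hQ₁ hQ₂ hQ₃) (h₃ Q hQ₁ hQ₂ hQ₃))

end

section

variable (A : Type u) [Category.{v} A] [Preadditive A] [Linear k A]
  [HasDerivedCategory.{w} (LinMod k A)]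

/-- The objects of the perfect derived category of `A`: the triangulated subcategory of the
derived category of all `A`-modules that is generated by the finitely generated projective
modules (in degree `0`). -/
def isPerfect : ObjectProperty (DerivedCategory (LinMod k A)) :=
  triangulatedHull (fun X => ∃ Z : LinMod k A, Projective Z ∧ Z.IsFinitelyGenerated ∧
    Nonempty (X ≅ (DerivedCategory.singleFunctor (LinMod k A) 0).obj Z))

/-- The perfect derived category of `A`. -/
abbrev Per := (isPerfect k A).FullSubcategory

instance : (isPerfect k A).IsTriangulated := inferInstanceAs (triangulatedHull _).IsTriangulated

end

/-! ### The preimage of a subcategory of the stable category -/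

section

variable {E : Type u} [Category.{v} E] [Preadditive E] [Linear k E] [HasFiniteBiproducts E]
  (𝓔 : ExactStructure E) (T : ObjectProperty 𝓔.StableCategory)

/-- The full subcategory `M` of `E` on the objects whose image in the stable category
lies in `T`. -/
abbrev ExactStructure.preimage : ObjectProperty E := T.inverseImage 𝓔.toStable

/-- The projection functor from the preimage `M` of `T` to `T`. -/
def ExactStructure.projection :
    (𝓔.preimage T).FullSubcategory ⥤ T.FullSubcategory :=
  T.lift ((𝓔.preimage T).ι ⋙ 𝓔.toStable) (fun X => X.property)

instance : (𝓔.projection T).Additive where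

instance : (𝓔.projection T).Linear k where

/-- A finitely presented `T`-module, viewed as an `M`-module and then as an object of the derived
category of all `M`-modules concentrated in degree `0`; here `M` is the preimage of `T`. -/
def ExactStructure.stableModuleToDerived
    [HasDerivedCategory.{w} (LinMod k (𝓔.preimage T).FullSubcategory)] :
    (LinMod.isFinitelyPresented k T.FullSubcategory).FullSubcategory ⥤
      DerivedCategory (LinMod k (𝓔.preimage T).FullSubcategory) :=
  (LinMod.isFinitelyPresented k T.FullSubcategory).ι ⋙ LinMod.restrict k (𝓔.projection T) ⋙
    DerivedCategory.singleFunctor _ 0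

end

end Modules

/-! ### Dimension shifting along projective resolutions of length three -/

section ProjectiveResolutions

open Abelian

variable {A : Type*} [Category* A] [Abelian A]

section DimensionShift

variable [HasExt.{w} A] {S : ShortComplex A} (hS : S.ShortExact)

include hS

/-! A conflation A → B → D has a connecting morphism c : D → SA. A map f : X → D lifts to B exactly
when fc vanishes stably, and a map A → N extends over B exactly when c followed by its suspension
vanishes. Since Ext¹(X, A) is the stable group C(X, SA), rigidity of T says that all such
obstructions vanish between objects of M.

For (a), adding a projective turns a stable approximation into a deflation M₀ → X. If N ∈ M, a map N
→ SM₁ dies in C(N, SM₀) = 0, so it comes from some N → X; this factors stably through M₀, so the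
original map is zero, and maximality puts the kernel M₁ in M. For (b), the sequence Hom(N, M₁) →
Hom(N, M₀) → Ext¹(N, K) → Ext¹(N, M₁) = 0 is a presentation of Ext¹(?, K).

For (c), splice the conflations K → M₁ → M₀ from (b) and M₃ → M₂ → K from (a) into a resolution 0 →
M₃^ → M₂^ → M₁^ → M₀^ → Z → 0; hence Z is perfect. Applying Hom(?, N^) leaves only Ext³(Z, N^) =
cok(Hom(M₂, N) → Hom(M₃, N)) ≅ C(K, SN). On the other side Hom(N^, Z) ≅ C(N, SK) ≅ C(SN, S²K), and
the Calabi-Yau property identifies the latter with the dual of C(K, SN).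

To get naturality, the duality is packed into one linear form on Hom(Z, Z[3]): the class of g : M₃ →
M₀ goes to the stable trace of K → SM₃ → SM₀ → S²K. The pairing it defines is perfect at the shifts
of representables (`exists_isTrace_isPerfectAt`), hence on all of per(M) by the five lemma
(`IsPerfectAt.of_distinguished`). Naturality in Y is built into the pairing; naturality in Z is the
cyclicity of the forms (`IsTrace.cyclic`), inherited from the stable trace. -/

lemma CategoryTheory.ShortComplex.ShortExact.exists_extClass_comp_eq [Projective S.X₂] {Y : A}
    {n m : ℕ} (h : 1 + n = m) (x : Ext S.X₃ Y m) : ∃ y, hS.extClass.comp y h = x := by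
  obtain rfl : m = n + 1 := by lia
  exact Ext.contravariant_sequence_exact₃ hS Y x (Ext.eq_zero_of_projective _) h

/-- The obstruction to injectivity is Ext of the projective middle term in degree n + 1, which
vanishes because this degree is positive; in degree 0 injectivity would fail. -/
lemma CategoryTheory.ShortComplex.ShortExact.eq_zero_of_extClass_comp [Projective S.X₂] {Y : A}
    {n m : ℕ} (h : 1 + (n + 1) = m) (x : Ext S.X₁ Y (n + 1)) (hx : hS.extClass.comp x h = 0) :
    x = 0 := by
  obtain ⟨y, rfl⟩ := Ext.contravariant_sequence_exact₁ hS Y x h hx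
  rw [Ext.eq_zero_of_projective y, Ext.comp_zero]

lemma CategoryTheory.ShortComplex.ShortExact.extClass_comp_mk₀_eq_zero_iff {Y : A}
    (f : S.X₁ ⟶ Y) :
    hS.extClass.comp (Ext.mk₀ f) (add_zero 1) = 0 ↔ ∃ g : S.X₂ ⟶ Y, f = S.f ≫ g := by
  constructor
  · intro h
    obtain ⟨y, hy⟩ := Ext.contravariant_sequence_exact₁ hS Y _ (add_zero 1) h
    obtain ⟨g, rfl⟩ := (Ext.mk₀_bijective _ _).2 y
    rw [Ext.mk₀_comp_mk₀] at hy
    exact ⟨g, (Ext.mk₀_bijective _ _).1 hy.symm⟩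
  · rintro ⟨g, rfl⟩
    rw [← Ext.mk₀_comp_mk₀]
    exact hS.extClass_comp_assoc _

end DimensionShift

/-- A resolution `0 ⟶ P₃ ⟶ P₂ ⟶ P₁ ⟶ P₀ ⟶ Z ⟶ 0`, cut into short exact sequences. -/
structure LengthThreeResolution (P₃ P₂ P₁ P₀ Z : A) where
  /-- the first syzygy -/
  Ω : A
  /-- the second syzygy -/
  K : A
  d₃ : P₃ ⟶ P₂
  q₂ : P₂ ⟶ K
  i₁ : K ⟶ P₁
  q₁ : P₁ ⟶ Ω
  i₀ : Ω ⟶ P₀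
  π : P₀ ⟶ Z
  zero₃ : d₃ ≫ q₂ = 0
  zero₂ : i₁ ≫ q₁ = 0
  zero₁ : i₀ ≫ π = 0
  exact₃ : (ShortComplex.mk d₃ q₂ zero₃).ShortExact
  exact₂ : (ShortComplex.mk i₁ q₁ zero₂).ShortExact
  exact₁ : (ShortComplex.mk i₀ π zero₁).ShortExact

namespace LengthThreeResolution

variable {P₃ P₂ P₁ P₀ Z : A} (R : LengthThreeResolution P₃ P₂ P₁ P₀ Z)

/-- The differential `P₂ ⟶ P₁`. -/
def d₂ : P₂ ⟶ P₁ := R.q₂ ≫ R.i₁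

/-- The differential `P₁ ⟶ P₀`. -/
def d₁ : P₁ ⟶ P₀ := R.q₁ ≫ R.i₀

instance : Epi R.q₁ := R.exact₂.epi_g
instance : Epi R.q₂ := R.exact₃.epi_g
instance : Mono R.i₀ := R.exact₁.mono_f
instance : Mono R.i₁ := R.exact₂.mono_f

section

variable [HasExt.{w} A]

/-- The Yoneda class of a resolution of length three. -/
noncomputable def yonedaClass : Ext.{w} Z P₃ 3 :=
  R.exact₁.extClass.comp (R.exact₂.extClass.comp R.exact₃.extClass (c := 2) rfl) rfl

lemma yonedaClass_comp {W : A} {n m : ℕ} (x : Ext P₃ W n) (h : 3 + n = m) :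
    R.yonedaClass.comp x h = R.exact₁.extClass.comp (R.exact₂.extClass.comp
      (R.exact₃.extClass.comp x (rfl : 1 + n = 1 + n)) (rfl : 1 + (1 + n) = _)) (by lia) := by
  rw [yonedaClass, Ext.comp_assoc (a₂₃ := 1 + (1 + n)) _ _ _ _ (by lia) (by lia),
    Ext.comp_assoc (a₂₃ := 1 + n) _ _ _ _ (by lia) (by lia)]

variable [Projective P₂] [Projective P₁] [Projective P₀]

/-- Dimension shifting three times, each time past a projective middle term. Together with the next
lemma it computes Ext³(Z, W) as the cokernel of Hom(P₂, W) → Hom(P₃, W). -/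
lemma exists_yonedaClass_comp_eq {W : A} {n m : ℕ} (h : 3 + n = m) (x : Ext Z W m) :
    ∃ y, R.yonedaClass.comp y h = x := by
  have : Projective (ShortComplex.mk _ _ R.zero₁).X₂ := ‹Projective P₀›
  have : Projective (ShortComplex.mk _ _ R.zero₂).X₂ := ‹Projective P₁›
  have : Projective (ShortComplex.mk _ _ R.zero₃).X₂ := ‹Projective P₂›
  obtain ⟨x₁, rfl⟩ := R.exact₁.exists_extClass_comp_eq (n := 1 + (1 + n)) (by lia) x
  obtain ⟨x₂, rfl⟩ := R.exact₂.exists_extClass_comp_eq rfl x₁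
  obtain ⟨x₃, rfl⟩ := R.exact₃.exists_extClass_comp_eq rfl x₂
  exact ⟨x₃, R.yonedaClass_comp _ _⟩

lemma yonedaClass_comp_mk₀_eq_zero_iff {W : A} (f : P₃ ⟶ W) :
    R.yonedaClass.comp (Ext.mk₀ f) (add_zero 3) = 0 ↔ ∃ g : P₂ ⟶ W, f = R.d₃ ≫ g := by
  have : Projective (ShortComplex.mk _ _ R.zero₁).X₂ := ‹Projective P₀›
  have : Projective (ShortComplex.mk _ _ R.zero₂).X₂ := ‹Projective P₁›
  refine Iff.trans ?_ (R.exact₃.extClass_comp_mk₀_eq_zero_iff f)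
  rw [yonedaClass_comp]
  -- The two outer connecting maps act on Ext¹(K, W) and Ext²(Ω, W), positive degrees in which they
  -- are injective.
  refine ⟨fun h => ?_, fun h => ?_⟩
  · exact R.exact₂.eq_zero_of_extClass_comp _ _ (R.exact₁.eq_zero_of_extClass_comp _ _ h)
  · rw [h, Ext.comp_zero, Ext.comp_zero]

/-- The groups `Ext n Z W` vanish for `n ≠ 3` if the complex `Hom(P, W)` is exact except in
degree `3`. -/
lemma ext_eq_zero [Projective P₃] {W : A} (h₀ : ∀ f : Z ⟶ W, f = 0)
    (h₁ : ∀ f : P₁ ⟶ W, R.d₂ ≫ f = 0 → ∃ g, f = R.d₁ ≫ g)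
    (h₂ : ∀ f : P₂ ⟶ W, R.d₃ ≫ f = 0 → ∃ g, f = R.d₂ ≫ g)
    (n : ℕ) (hn : n ≠ 3) (x : Ext Z W n) : x = 0 := by
  have : Projective (ShortComplex.mk _ _ R.zero₁).X₂ := ‹Projective P₀›
  have : Projective (ShortComplex.mk _ _ R.zero₂).X₂ := ‹Projective P₁›
  match n, hn with
  | 0, _ =>
    obtain ⟨f, rfl⟩ := (Ext.mk₀_bijective _ _).2 x
    rw [h₀ f, Ext.mk₀_zero]
  | 1, _ =>
    obtain ⟨x₁, rfl⟩ := R.exact₁.exists_extClass_comp_eq (add_zero 1) x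
    obtain ⟨f, rfl⟩ := (Ext.mk₀_bijective _ _).2 x₁
    refine (R.exact₁.extClass_comp_mk₀_eq_zero_iff f).2 ?_
    obtain ⟨g, hg⟩ := h₁ (R.q₁ ≫ f) (by
      rw [d₂, Category.assoc, ← Category.assoc R.i₁, R.zero₂, zero_comp, comp_zero])
    exact ⟨g, by rw [← cancel_epi R.q₁, hg, d₁, Category.assoc]⟩
  | 2, _ =>
    obtain ⟨x₁, rfl⟩ := R.exact₁.exists_extClass_comp_eq (n := 1) rfl x
    obtain ⟨x₂, rfl⟩ := R.exact₂.exists_extClass_comp_eq (add_zero 1) x₁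
    obtain ⟨f, rfl⟩ := (Ext.mk₀_bijective _ _).2 x₂
    obtain ⟨g, hg⟩ := h₂ (R.q₂ ≫ f) (by
      rw [← Category.assoc, R.zero₃, zero_comp])
    rw [(R.exact₂.extClass_comp_mk₀_eq_zero_iff f).2
      ⟨g, by rw [← cancel_epi R.q₂, hg, d₂, Category.assoc]⟩, Ext.comp_zero]
  | n + 4, _ =>
    -- Beyond degree 3 the shift lands in a positive Ext of the projective P₃.
    obtain ⟨y, rfl⟩ := R.exists_yonedaClass_comp_eq (n := n + 1) (by lia) x
    rw [Ext.eq_zero_of_projective y, Ext.comp_zero]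

end

/-- A morphism of resolutions induces morphisms ω and κ on the syzygies; the naturality squares of
the three extension classes are then pasted together. -/
lemma yonedaClass_naturality [HasExt.{w} A] {P₃' P₂' P₁' P₀' Z' : A}
    (R' : LengthThreeResolution P₃' P₂' P₁' P₀' Z') (f₃ : P₃ ⟶ P₃') (f₂ : P₂ ⟶ P₂')
    (f₁ : P₁ ⟶ P₁') (f₀ : P₀ ⟶ P₀') (z : Z ⟶ Z')
    (h₃ : R.d₃ ≫ f₂ = f₃ ≫ R'.d₃) (h₂ : R.d₂ ≫ f₁ = f₂ ≫ R'.d₂)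
    (h₁ : R.d₁ ≫ f₀ = f₁ ≫ R'.d₁) (h₀ : R.π ≫ z = f₀ ≫ R'.π) :
    R.yonedaClass.comp (Ext.mk₀ f₃) (add_zero 3) =
      (Ext.mk₀ z).comp R'.yonedaClass (zero_add 3) := by
  have e₁ : (R.i₀ ≫ f₀) ≫ R'.π = 0 := by
    rw [Category.assoc, ← h₀, ← Category.assoc, R.zero₁, zero_comp]
  obtain ⟨ω, hω⟩ : ∃ ω : R.Ω ⟶ R'.Ω, ω ≫ R'.i₀ = R.i₀ ≫ f₀ :=
    ⟨_, R'.exact₁.exact.lift_f _ e₁⟩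
  have hω' : R.q₁ ≫ ω = f₁ ≫ R'.q₁ := by
    rw [← cancel_mono R'.i₀, Category.assoc, hω, Category.assoc]
    simpa only [d₁, Category.assoc] using h₁
  have e₂ : (R.i₁ ≫ f₁) ≫ R'.q₁ = 0 := by
    rw [Category.assoc, ← hω', ← Category.assoc, R.zero₂, zero_comp]
  obtain ⟨κ, hκ⟩ : ∃ κ : R.K ⟶ R'.K, κ ≫ R'.i₁ = R.i₁ ≫ f₁ :=
    ⟨_, R'.exact₂.exact.lift_f _ e₂⟩
  have hκ' : R.q₂ ≫ κ = f₂ ≫ R'.q₂ := by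
    rw [← cancel_mono R'.i₁, Category.assoc, hκ, Category.assoc]
    simpa only [d₂, Category.assoc] using h₂
  have n₁ := ShortComplex.ShortExact.extClass_naturality R.exact₁ R'.exact₁
    { τ₁ := ω, τ₂ := f₀, τ₃ := z, comm₁₂ := hω, comm₂₃ := h₀.symm }
  have n₂ := ShortComplex.ShortExact.extClass_naturality R.exact₂ R'.exact₂
    { τ₁ := κ, τ₂ := f₁, τ₃ := ω, comm₁₂ := hκ, comm₂₃ := hω'.symm }
  have n₃ := ShortComplex.ShortExact.extClass_naturality R.exact₃ R'.exact₃
    { τ₁ := f₃, τ₂ := f₂, τ₃ := κ, comm₁₂ := h₃.symm, comm₂₃ := hκ'.symm }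
  dsimp only at n₁ n₂ n₃
  rw [yonedaClass_comp, n₃, ← Ext.comp_assoc_of_second_deg_zero, n₂, yonedaClass,
    ← Ext.comp_assoc (a₁₂ := 1) (Ext.mk₀ z) _ _ (by lia) (by lia) (by lia), ← n₁,
    Ext.comp_assoc_of_second_deg_zero,
    Ext.comp_assoc (a₂₃ := 2) (Ext.mk₀ ω) _ _ (by lia) (by lia) (by lia)]

end LengthThreeResolution

end ProjectiveResolutions

/-! ### Perfect pairings on triangulated categories -/

section Pairings

open Pretriangulated

variable {k : Type*} [Field k]

/-- Over a field, φ descends to the image of f and then extends to all of V'. This is how forms are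
passed down to quotients of Hom spaces throughout the proof. -/
lemma exists_dual_comp_eq {V V' : Type*} [AddCommGroup V] [Module k V] [AddCommGroup V']
    [Module k V'] (f : V →ₗ[k] V') (φ : Module.Dual k V) (h : ∀ v, f v = 0 → φ v = 0) :
    ∃ ψ : Module.Dual k V', ∀ v, ψ (f v) = φ v := by
  have : φ ∈ LinearMap.range f.dualMap := by
    rw [LinearMap.range_dualMap_eq_dualAnnihilator_ker, Submodule.mem_dualAnnihilator]
    exact fun v hv => h v hv
  obtain ⟨ψ, rfl⟩ := this
  exact ⟨ψ, fun _ => rfl⟩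

variable {D : Type*} [Category* D] [Preadditive D] [Linear k D] {Z W : D}
  (t : (Z ⟶ W) →ₗ[k] k)

/-- The pairing of `Hom(Y, W)` and `Hom(Z, Y)` defined by a linear form on `Hom(Z, W)`. -/
def tracePairing (Y : D) : (Y ⟶ W) →ₗ[k] Module.Dual k (Z ⟶ Y) :=
  LinearMap.mk₂ k (fun b a => t (a ≫ b)) (by simp) (by simp) (by simp) (by simp)

@[simp]
lemma tracePairing_apply (Y : D) (b : Y ⟶ W) (a : Z ⟶ Y) : tracePairing t Y b a = t (a ≫ b) :=
  rfl

/-- The trace pairing identifies `Hom(Y, W)` with the dual of `Hom(Z, Y)`. -/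
def IsPerfectAt : ObjectProperty D := fun Y => Function.Bijective (tracePairing t Y)

variable {t}

lemma IsPerfectAt.eq_zero {Y : D} (h : IsPerfectAt t Y) (b : Y ⟶ W)
    (hb : ∀ a : Z ⟶ Y, t (a ≫ b) = 0) : b = 0 :=
  (injective_iff_map_eq_zero _).1 h.1 b (LinearMap.ext hb)

lemma IsPerfectAt.exists_eq {Y : D} (h : IsPerfectAt t Y) (φ : Module.Dual k (Z ⟶ Y)) :
    ∃ b : Y ⟶ W, ∀ a, t (a ≫ b) = φ a := by
  obtain ⟨b, rfl⟩ := h.2 φ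
  exact ⟨b, fun _ => rfl⟩

lemma isPerfectAt_of {Y : D} (h₁ : ∀ b : Y ⟶ W, (∀ a : Z ⟶ Y, t (a ≫ b) = 0) → b = 0)
    (h₂ : ∀ φ : Module.Dual k (Z ⟶ Y), ∃ b : Y ⟶ W, ∀ a, t (a ≫ b) = φ a) :
    IsPerfectAt t Y :=
  ⟨(injective_iff_map_eq_zero _).2 fun b hb => h₁ b fun a => LinearMap.congr_fun hb a,
    fun φ => (h₂ φ).imp fun _ hb => LinearMap.ext hb⟩

lemma isPerfectAt_of_eq_zero {Y : D} (h₁ : ∀ b : Y ⟶ W, b = 0) (h₂ : ∀ a : Z ⟶ Y, a = 0) :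
    IsPerfectAt t Y :=
  isPerfectAt_of (fun b _ => h₁ b) fun φ => ⟨0, fun a => by rw [h₂ a, zero_comp]; simp⟩

/-- Finitely generated projectives are only retracts of representables, so perfection must pass to
retracts. -/
lemma IsPerfectAt.of_retract {X Y : D} (h : IsPerfectAt t Y) (r : Retract X Y) :
    IsPerfectAt t X := by
  refine isPerfectAt_of (fun b hb => ?_) fun φ => ?_
  · have : r.r ≫ b = 0 := h.eq_zero _ fun a => by
      rw [← Category.assoc]
      exact hb _
    rw [← Category.id_comp b, ← r.retract, Category.assoc, this, comp_zero]
  · obtain ⟨b, hb⟩ := h.exists_eq (φ ∘ₗ Linear.rightComp k Z r.r)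
    refine ⟨r.i ≫ b, fun a => ?_⟩
    rw [← Category.assoc, hb]
    simp

variable [HasZeroObject D] [HasShift D ℤ] [∀ n : ℤ, (shiftFunctor D n).Additive]
  [Pretriangulated D]

/-- The five lemma for the pairing, between the long exact sequence of Hom(?, W) and the dual of
that of Hom(Z, ?). Dualizing over a field is exact, so no finiteness is needed. -/
lemma IsPerfectAt.of_distinguished {T : Triangle D} (hT : T ∈ distTriang D)
    (h₀ : IsPerfectAt t (T.obj₃⟦(-1 : ℤ)⟧)) (h₁ : IsPerfectAt t T.obj₁)
    (h₃ : IsPerfectAt t T.obj₃) (h₄ : IsPerfectAt t (T.obj₁⟦(1 : ℤ)⟧)) :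
    IsPerfectAt t T.obj₂ := by
  refine isPerfectAt_of (fun b hb => ?_) fun φ => ?_
  · have hb' : T.mor₁ ≫ b = 0 := h₁.eq_zero _ fun a => by
      rw [← Category.assoc]
      exact hb _
    obtain ⟨c, rfl⟩ := Triangle.yoneda_exact₂ T hT b hb'
    -- Pairing with c kills the image of Hom(Z, X₂), so it factors through Hom(Z, X₁[1]) and is
    -- represented by some d. Then c = T.mor₃ ≫ d, and b vanishes as a composite containing two
    -- consecutive morphisms of the triangle.
    obtain ⟨ψ, hψ⟩ := exists_dual_comp_eq (Linear.rightComp k Z T.mor₃)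
      (tracePairing t _ c) (fun a ha => by
        obtain ⟨a', rfl⟩ := Triangle.coyoneda_exact₃ T hT a ha
        simpa using hb a')
    obtain ⟨d, hd⟩ := h₄.exists_eq ψ
    have : c - T.mor₃ ≫ d = 0 := h₃.eq_zero _ fun a => by
      have := hψ a
      rw [Linear.rightComp_apply, ← hd, tracePairing_apply] at this
      rw [Preadditive.comp_sub, map_sub, ← Category.assoc, this, sub_self]
    rw [sub_eq_zero.1 this, ← Category.assoc, comp_distTriang_mor_zero₂₃ _ hT, zero_comp]
  · obtain ⟨b₁, hb₁⟩ := h₁.exists_eq (φ ∘ₗ Linear.rightComp k Z T.mor₁)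
    -- The map preceding X₁ in the inverse rotation, kept abstract: composing b₁ with it is the
    -- obstruction to extending b₁ over X₂, and perfection at X₃[-1] kills this obstruction.
    obtain ⟨m, hm, hex⟩ : ∃ m : T.obj₃⟦(-1 : ℤ)⟧ ⟶ T.obj₁, m ≫ T.mor₁ = 0 ∧
        ∀ b : T.obj₁ ⟶ W, m ≫ b = 0 → ∃ b' : T.obj₂ ⟶ W, b = T.mor₁ ≫ b' :=
      have hT' := inv_rot_of_distTriang _ hT
      ⟨T.invRotate.mor₁, comp_distTriang_mor_zero₁₂ _ hT',
        fun b hb => Triangle.yoneda_exact₂ _ hT' b hb⟩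
    obtain ⟨b₂, hb₂⟩ := hex b₁ <| h₀.eq_zero _ fun a => by
      have := hb₁ (a ≫ m)
      rw [Category.assoc] at this
      rw [this]
      simp [hm]
    -- The extension b₂ represents φ on the image of Hom(Z, X₁). The remaining error factors through
    -- Hom(Z, X₃) and is corrected by c.
    obtain ⟨ψ, hψ⟩ := exists_dual_comp_eq (Linear.rightComp k Z T.mor₂)
      (φ - tracePairing t _ b₂) (fun a ha => by
        obtain ⟨a', rfl⟩ := Triangle.coyoneda_exact₂ T hT a ha
        have := hb₁ a'
        rw [hb₂] at this
        simpa [sub_eq_zero] using this.symm)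
    obtain ⟨c, hc⟩ := h₃.exists_eq ψ
    refine ⟨b₂ + T.mor₂ ≫ c, fun a => ?_⟩
    have := hψ a
    rw [Linear.rightComp_apply, ← hc] at this
    simp only [Category.assoc, LinearMap.sub_apply, tracePairing_apply] at this
    rw [Preadditive.comp_add, map_add, this, add_sub_cancel]

/-- If the trace pairing is perfect at all shifts of the objects of `P`, then it is perfect on the
triangulated subcategory generated by `P`. -/
lemma isPerfectAt_of_triangulatedHull (P : ObjectProperty D)
    (hP : ∀ Y, P Y → ∀ n : ℤ, IsPerfectAt t (Y⟦n⟧)) {Y : D} (hY : triangulatedHull P Y) :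
    IsPerfectAt t Y := by
  have iso {X Y : D} (e : X ≅ Y) (h : IsPerfectAt t X) : IsPerfectAt t Y :=
    h.of_retract (Retract.ofIso e.symm)
  -- All shifts are required at once because the five lemma also uses the neighbours X₃[-1] and
  -- X₁[1].
  let Q : ObjectProperty D := fun Y => ∀ n : ℤ, IsPerfectAt t (Y⟦n⟧)
  have hQ : Q.IsClosedUnderIsomorphisms :=
    ⟨fun e h n => iso ((shiftFunctor D n).mapIso e) (h n)⟩
  have hQ' : Q.IsTriangulated :=
    { exists_zero := by
        refine ⟨_, isZero_zero D, fun n => isPerfectAt_of_eq_zero ?_ ?_⟩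
        · exact fun b => ((shiftFunctor D n).map_isZero (isZero_zero D)).eq_of_src _ _
        · exact fun b => ((shiftFunctor D n).map_isZero (isZero_zero D)).eq_of_tgt _ _
      isStableUnderShiftBy := fun m =>
        { le_shift := fun Y hY n => iso ((shiftFunctorAdd' D m n _ rfl).app Y) (hY (m + n)) }
      toIsTriangulatedClosed₂ := .mk' fun T hT h₁ h₃ n => by
        refine IsPerfectAt.of_distinguished (Triangle.shift_distinguished T hT n) ?_ (h₁ n)
          (h₃ n) ?_
        · exact iso ((shiftFunctorAdd' D n (-1) _ rfl).app _) (h₃ _)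
        · exact iso ((shiftFunctorAdd' D n 1 _ rfl).app _) (h₁ _) }
  exact iso ((shiftFunctorZero D ℤ).app Y) (hY Q hQ' hQ hP 0)

end Pairings

/-! ### Morphisms between shifts of modules in the derived category -/

section Derived

open DerivedCategory Abelian

variable {A : Type u} [Category.{v} A] [Abelian A] [HasDerivedCategory.{w} A]

lemma singleFunctor_hom_shift_eq_zero_of_neg {X Y : A} {n : ℤ} (hn : n < 0)
    (f : (singleFunctor A 0).obj X ⟶ ((singleFunctor A 0).obj Y)⟦n⟧) : f = 0 := by
  have := TStructure.t.isGE_shift ((singleFunctor A 0).obj Y) 0 n (-n) (by lia)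
  exact TStructure.t.zero f 0 (-n) (by lia)

lemma singleFunctor_hom_shift_eq_zero [HasExt.{w} A] {X Y : A} {n : ℤ}
    (h : ∀ m : ℕ, (m : ℤ) = n → ∀ x : Ext X Y m, x = 0)
    (f : (singleFunctor A 0).obj X ⟶ ((singleFunctor A 0).obj Y)⟦n⟧) : f = 0 := by
  by_cases hn : n < 0
  · exact singleFunctor_hom_shift_eq_zero_of_neg hn f
  · lift n to ℕ using by lia
    obtain ⟨x, rfl⟩ := Ext.homAddEquiv.surjective f
    rw [h n rfl x, map_zero]

lemma shift_hom_shift_eq_zero {C : Type*} [Category* C] [Preadditive C] [HasShift C ℤ]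
    [∀ n : ℤ, (shiftFunctor C n).Additive] {X Y : C} {a b c : ℤ} (h : c + a = b)
    (hc : ∀ f : X ⟶ Y⟦c⟧, f = 0) (f : X⟦a⟧ ⟶ Y⟦b⟧) : f = 0 := by
  obtain ⟨g, hg⟩ := (shiftFunctor C a).map_surjective (f ≫ (shiftFunctorAdd' C c a b h).hom.app Y)
  rw [← cancel_mono ((shiftFunctorAdd' C c a b h).hom.app Y), ← hg, hc g, Functor.map_zero,
    zero_comp]

end Derived

/-! ### Resolutions of length three in the derived category -/

section Derived

open DerivedCategory Abelian

variable {A : Type u} [Category.{v} A] [Abelian A] [HasDerivedCategory.{w} A]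

lemma CategoryTheory.ShortComplex.ShortExact.prop_singleFunctor_obj {S : ShortComplex A}
    (hS : S.ShortExact) (P : ObjectProperty (DerivedCategory A)) [P.IsTriangulated]
    [P.IsClosedUnderIsomorphisms] (h₁ : P ((singleFunctor A 0).obj S.X₁))
    (h₂ : P ((singleFunctor A 0).obj S.X₂)) : P ((singleFunctor A 0).obj S.X₃) :=
  P.ext_of_isTriangulatedClosed₃ _ hS.singleTriangle_distinguished h₁ h₂

namespace LengthThreeResolution

variable {P₃ P₂ P₁ P₀ Z : A} (R : LengthThreeResolution P₃ P₂ P₁ P₀ Z)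

include R in
lemma prop_singleFunctor_obj (P : ObjectProperty (DerivedCategory A)) [P.IsTriangulated]
    [P.IsClosedUnderIsomorphisms] (h₃ : P ((singleFunctor A 0).obj P₃))
    (h₂ : P ((singleFunctor A 0).obj P₂)) (h₁ : P ((singleFunctor A 0).obj P₁))
    (h₀ : P ((singleFunctor A 0).obj P₀)) : P ((singleFunctor A 0).obj Z) :=
  R.exact₁.prop_singleFunctor_obj P (R.exact₂.prop_singleFunctor_obj P
    (R.exact₃.prop_singleFunctor_obj P h₃ h₂) h₁) h₀

/-- The morphism `Z ⟶ P₃[3]` in the derived category defined by a resolution. -/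
noncomputable def connecting :
    (singleFunctor A 0).obj Z ⟶ ((singleFunctor A 0).obj P₃)⟦(3 : ℤ)⟧ :=
  letI := hasExt_of_hasDerivedCategory A
  R.yonedaClass.hom

lemma connecting_naturality {P₃' P₂' P₁' P₀' Z' : A}
    (R' : LengthThreeResolution P₃' P₂' P₁' P₀' Z') (f₃ : P₃ ⟶ P₃') (f₂ : P₂ ⟶ P₂')
    (f₁ : P₁ ⟶ P₁') (f₀ : P₀ ⟶ P₀') (z : Z ⟶ Z')
    (h₃ : R.d₃ ≫ f₂ = f₃ ≫ R'.d₃) (h₂ : R.d₂ ≫ f₁ = f₂ ≫ R'.d₂)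
    (h₁ : R.d₁ ≫ f₀ = f₁ ≫ R'.d₁) (h₀ : R.π ≫ z = f₀ ≫ R'.π) :
    R.connecting ≫ ((singleFunctor A 0).map f₃)⟦(3 : ℤ)⟧' =
      (singleFunctor A 0).map z ≫ R'.connecting := by
  let := hasExt_of_hasDerivedCategory A
  have := congrArg Ext.hom (R.yonedaClass_naturality R' f₃ f₂ f₁ f₀ z h₃ h₂ h₁ h₀)
  rw [Ext.comp_hom, Ext.comp_hom, Ext.mk₀_hom, Ext.mk₀_hom, ShiftedHom.comp_mk₀,
    ShiftedHom.mk₀_comp] at this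
  exact this

variable {k : Type t} [Field k] [Linear k A]

variable (k) in
/-- The map `Hom(P₃, W) ⟶ Hom(Z, W[3])` defined by a resolution. -/
noncomputable def toShiftedHom (W : A) : (P₃ ⟶ W) →ₗ[k]
    ((singleFunctor A 0).obj Z ⟶ ((singleFunctor A 0).obj W)⟦(3 : ℤ)⟧) :=
  Linear.leftComp k _ R.connecting ∘ₗ
    (shiftFunctor (DerivedCategory A) (3 : ℤ)).mapLinearMap k ∘ₗ (singleFunctor A 0).mapLinearMap k

lemma toShiftedHom_apply {W : A} (f : P₃ ⟶ W) : R.toShiftedHom k W f =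
    R.connecting ≫ ((singleFunctor A 0).map f)⟦(3 : ℤ)⟧' := rfl

lemma toShiftedHom_comp {W W' : A} (f : P₃ ⟶ W) (g : W ⟶ W') :
    R.toShiftedHom k W' (f ≫ g) =
      R.toShiftedHom k W f ≫ ((singleFunctor A 0).map g)⟦(3 : ℤ)⟧' := by
  simp [toShiftedHom_apply]

variable [Projective P₂] [Projective P₁] [Projective P₀]

lemma toShiftedHom_surjective (W : A) : Function.Surjective (R.toShiftedHom k W) := by
  let := hasExt_of_hasDerivedCategory A
  intro x
  obtain ⟨x, rfl⟩ := (Ext.homEquiv (n := 3)).surjective x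
  obtain ⟨y, rfl⟩ := R.exists_yonedaClass_comp_eq (add_zero 3) x
  obtain ⟨f, rfl⟩ := (Ext.mk₀_bijective _ _).2 y
  refine ⟨f, Eq.symm ?_⟩
  refine (Ext.comp_hom _ _ _).trans ?_
  rw [Ext.mk₀_hom, ShiftedHom.comp_mk₀]
  rfl

lemma toShiftedHom_eq_zero_iff {W : A} (f : P₃ ⟶ W) :
    R.toShiftedHom k W f = 0 ↔ ∃ g : P₂ ⟶ W, f = R.d₃ ≫ g := by
  let := hasExt_of_hasDerivedCategory A
  rw [← R.yonedaClass_comp_mk₀_eq_zero_iff, ← Ext.homAddEquiv.map_eq_zero_iff,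
    Ext.homAddEquiv_apply, Ext.comp_hom, Ext.mk₀_hom, ShiftedHom.comp_mk₀]
  rfl

lemma exists_dual_toShiftedHom {W : A} (φ : Module.Dual k (P₃ ⟶ W))
    (hφ : ∀ g : P₂ ⟶ W, φ (R.d₃ ≫ g) = 0) :
    ∃ ψ : Module.Dual k ((singleFunctor A 0).obj Z ⟶ ((singleFunctor A 0).obj W)⟦(3 : ℤ)⟧),
      ∀ f, ψ (R.toShiftedHom k W f) = φ f :=
  exists_dual_comp_eq _ φ fun f hf => by
    obtain ⟨g, rfl⟩ := (R.toShiftedHom_eq_zero_iff f).1 hf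
    exact hφ g

/-- A criterion for the perfection of the trace pairing at the shifts of a projective object. -/
lemma isPerfectAt_shift [Projective P₃] {N : A} [Projective N] (h₀ : ∀ f : Z ⟶ N, f = 0)
    (h₁ : ∀ f : P₁ ⟶ N, R.d₂ ≫ f = 0 → ∃ g, f = R.d₁ ≫ g)
    (h₂ : ∀ f : P₂ ⟶ N, R.d₃ ≫ f = 0 → ∃ g, f = R.d₂ ≫ g) (τ : (P₃ ⟶ Z) →ₗ[k] k)
    (t : ((singleFunctor A 0).obj Z ⟶ ((singleFunctor A 0).obj Z)⟦(3 : ℤ)⟧) →ₗ[k] k)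
    (ht : ∀ f, t (R.toShiftedHom k Z f) = τ f)
    (hinj : ∀ b : N ⟶ Z, (∀ f : P₃ ⟶ N, τ (f ≫ b) = 0) → b = 0)
    (hsurj : ∀ φ : Module.Dual k (P₃ ⟶ N), (∀ g : P₂ ⟶ N, φ (R.d₃ ≫ g) = 0) →
      ∃ b : N ⟶ Z, ∀ f : P₃ ⟶ N, τ (f ≫ b) = φ f) (n : ℤ) :
    IsPerfectAt t (((singleFunctor A 0).obj N)⟦n⟧) := by
  let := hasExt_of_hasDerivedCategory A
  by_cases hn : n = 3
  · subst hn
    have key (b : N ⟶ Z) (f : P₃ ⟶ N) : t (R.toShiftedHom k N f ≫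
        ((singleFunctor A 0).map b)⟦(3 : ℤ)⟧') = τ (f ≫ b) := by
      rw [← toShiftedHom_comp, ht]
    refine isPerfectAt_of (fun b hb => ?_) fun φ => ?_
    · obtain ⟨b, rfl⟩ := (shiftFunctor _ _).map_surjective b
      obtain ⟨b, rfl⟩ := (singleFunctor A 0).map_surjective b
      rw [hinj b fun f => by rw [← key, hb], Functor.map_zero, Functor.map_zero]
    · obtain ⟨b, hb⟩ := hsurj (φ ∘ₗ R.toShiftedHom k N) fun g => by
        rw [LinearMap.comp_apply, (R.toShiftedHom_eq_zero_iff _).2 ⟨g, rfl⟩, map_zero]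
      refine ⟨((singleFunctor A 0).map b)⟦(3 : ℤ)⟧', fun a => ?_⟩
      obtain ⟨f, rfl⟩ := R.toShiftedHom_surjective (k := k) N a
      rw [key, hb, LinearMap.comp_apply]
  -- Away from n = 3 both sides vanish: Hom(N[n], Z[3]) is Ext of degree 3 - n ≠ 0 out of the
  -- projective N, and Hom(Z, N[n]) is Ext of degree n ≠ 3.
  · refine isPerfectAt_of_eq_zero
      (shift_hom_shift_eq_zero (c := 3 - n) (by lia) (singleFunctor_hom_shift_eq_zero ?_))
      (singleFunctor_hom_shift_eq_zero ?_)
    · rintro (_ | m) hm x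
      · simp at hm
        lia
      · exact Ext.eq_zero_of_projective x
    · exact fun m hm x => R.ext_eq_zero h₀ h₁ h₂ m (by lia) x

end LengthThreeResolution

end Derived

/-! ### Conflations -/

namespace ExactStructure

section Conflations

variable {E : Type u} [Category.{v} E] [Preadditive E] {𝓔 : ExactStructure E}

namespace IsConflation

variable {A B D : E} {i : A ⟶ B} {p : B ⟶ D} (h : 𝓔.IsConflation i p)

include h

lemma mono : Mono i := by
  obtain ⟨h0, hc⟩ := h
  obtain ⟨hl⟩ := 𝓔.isKernel _ hc
  exact ⟨fun a b hab => Fork.IsLimit.hom_ext hl hab⟩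

lemma zero : i ≫ p = 0 := h.1

lemma exists_factor {X : E} (f : X ⟶ B) (hf : f ≫ p = 0) : ∃ g : X ⟶ A, g ≫ i = f := by
  obtain ⟨h0, hc⟩ := h
  obtain ⟨hl⟩ := 𝓔.isKernel _ hc
  exact ⟨hl.lift (KernelFork.ofι f hf), hl.fac _ WalkingParallelPair.zero⟩

lemma isDeflation : IsDeflationOf 𝓔.conflation p := ⟨A, i, h.1, h.2⟩

end IsConflation

lemma exists_isConflation {B D : E} {p : B ⟶ D} (hp : IsDeflationOf 𝓔.conflation p) :
    ∃ (A : E) (i : A ⟶ B), 𝓔.IsConflation i p := by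
  obtain ⟨A, i, h, hc⟩ := hp
  exact ⟨A, i, h, hc⟩

/-- The kernel of a deflation is unique up to isomorphism and conflations are closed under
isomorphism, so any kernel will do. -/
lemma isConflation_of_isDeflation {A B D : E} {i : A ⟶ B} {p : B ⟶ D}
    (hp : IsDeflationOf 𝓔.conflation p) [Mono i] (hi : i ≫ p = 0)
    (h : ∀ {X : E} (f : X ⟶ B), f ≫ p = 0 → ∃ g, g ≫ i = f) : 𝓔.IsConflation i p := by
  obtain ⟨A', i', h'⟩ := exists_isConflation hp
  have := h'.mono
  obtain ⟨a, ha⟩ := h i' h'.zero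
  obtain ⟨b, hb⟩ := h'.exists_factor i hi
  refine ⟨hi, 𝓔.of_iso (S := ShortComplex.mk i' p h'.zero) ?_ h'.2⟩
  exact ShortComplex.isoMk ⟨a, b,
    by rw [← cancel_mono i', Category.assoc, hb, ha, Category.id_comp],
    by rw [← cancel_mono i, Category.assoc, ha, hb, Category.id_comp]⟩ (Iso.refl _) (Iso.refl _)
    (by simpa using ha) (by simp)

lemma isDeflation_of_iso {B D B' D' : E} {p : B ⟶ D} {p' : B' ⟶ D'} (e : B ≅ B') (e' : D ≅ D')
    (w : e.hom ≫ p' = p ≫ e'.hom) (hp : IsDeflationOf 𝓔.conflation p) :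
    IsDeflationOf 𝓔.conflation p' := by
  obtain ⟨A, i, h⟩ := exists_isConflation hp
  have h0 : (i ≫ e.hom) ≫ p' = 0 := by
    rw [Category.assoc, w, ← Category.assoc, h.zero, zero_comp]
  exact ⟨A, i ≫ e.hom, h0, 𝓔.of_iso (ShortComplex.isoMk (S₁ := ShortComplex.mk i p h.zero)
    (S₂ := ShortComplex.mk _ _ h0)
    (Iso.refl _) e e' (by simp) w) h.2⟩

/-- The pullback of a conflation along a morphism `f : D' ⟶ D`. -/
lemma IsConflation.exists_pullback {A B D D' : E} {i : A ⟶ B} {p : B ⟶ D}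
    (h : 𝓔.IsConflation i p) (f : D' ⟶ D) :
    ∃ (B' : E) (i' : A ⟶ B') (p' : B' ⟶ D') (f' : B' ⟶ B),
      𝓔.IsConflation i' p' ∧ i' ≫ f' = i ∧ f' ≫ p = p' ≫ f := by
  have := h.mono
  obtain ⟨B', f', p', sq, hp'⟩ := 𝓔.pullback_deflation p f h.isDeflation
  have w : i ≫ p = (0 : A ⟶ D') ≫ f := by rw [h.zero, zero_comp]
  have e : sq.lift i 0 w ≫ f' = i := sq.lift_fst _ _ _
  have : Mono (sq.lift i 0 w ≫ f') := by rwa [e]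
  have := mono_of_mono (sq.lift i 0 w) f'
  refine ⟨B', sq.lift i 0 w, p', f', ?_, e, sq.w⟩
  refine isConflation_of_isDeflation hp' (sq.lift_snd _ _ _) fun {X} x hx => ?_
  obtain ⟨g, hg⟩ := h.exists_factor (x ≫ f') (by
    rw [Category.assoc, sq.w, ← Category.assoc, hx, zero_comp])
  exact ⟨g, sq.hom_ext (by simpa using hg) (by simpa using hx.symm)⟩

/-! ### Deflations out of biproducts -/

section Biproducts

variable [HasBinaryBiproducts E]

lemma isDeflation_biprod_snd (X Y : E) :
    IsDeflationOf 𝓔.conflation (biprod.snd : X ⊞ Y ⟶ Y) := by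
  -- The cokernel O of the identity is a zero object, so X → O is a deflation; its pullback along Y
  -- → O is the projection from X ⊞ Y.
  obtain ⟨O, p, h0, hO⟩ := 𝓔.id_inflation X
  have hc : 𝓔.IsConflation (𝟙 X) p := ⟨h0, hO⟩
  have hp : p = 0 := by simpa using h0
  have hz {V : E} (a b : V ⟶ O) : a = b := by
    have hO' : (𝟙 O) = 0 := by
      have := hc.epi
      rw [← cancel_epi p, hp, zero_comp, zero_comp]
    rw [← Category.comp_id a, ← Category.comp_id b, hO', comp_zero, comp_zero]
  obtain ⟨B, f', p', sq, hp'⟩ := 𝓔.pullback_deflation p (0 : Y ⟶ O) hc.isDeflation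
  refine isDeflation_of_iso (p := p') ⟨biprod.lift f' p', sq.lift biprod.fst biprod.snd (hz _ _),
    ?_, ?_⟩ (Iso.refl Y) (by simp) hp'
  · apply sq.hom_ext <;> simp
  · ext <;> simp

lemma isDeflation_biprod_map_id {P X : E} (M : E) {p : P ⟶ X}
    (hp : IsDeflationOf 𝓔.conflation p) :
    IsDeflationOf 𝓔.conflation (biprod.map (𝟙 M) p) := by
  obtain ⟨B, f', p', sq, hp'⟩ := 𝓔.pullback_deflation p (biprod.snd : M ⊞ X ⟶ X) hp
  refine isDeflation_of_iso (p := p') ⟨biprod.lift (p' ≫ biprod.fst) f',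
    sq.lift biprod.snd (biprod.map (𝟙 M) p) (by simp), ?_, ?_⟩ (Iso.refl _) ?_ hp'
  · apply sq.hom_ext
    · simp
    · ext <;> simp [sq.w]
  · ext <;> simp
  · ext <;> simp [sq.w]

/-- Factor as (𝟙 ⊞ p) followed by (f, 𝟙): the first is a pullback of p, the second is a projection
up to a shear automorphism. Adding a projective cover thus turns any morphism into a deflation. -/
lemma isDeflation_biprod_desc {M P X : E} (f : M ⟶ X) {p : P ⟶ X}
    (hp : IsDeflationOf 𝓔.conflation p) :
    IsDeflationOf 𝓔.conflation (biprod.desc f p) := by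
  have h₁ : IsDeflationOf 𝓔.conflation (biprod.desc f (𝟙 X)) := by
    refine isDeflation_of_iso (p := (biprod.snd : M ⊞ X ⟶ X))
      ⟨biprod.lift biprod.fst (biprod.snd - biprod.fst ≫ f),
        biprod.lift biprod.fst (biprod.snd + biprod.fst ≫ f), ?_, ?_⟩ (Iso.refl _) ?_
      (isDeflation_biprod_snd M X)
    · ext <;> simp
    · ext <;> simp
    · ext <;> simp
  have := 𝓔.comp_deflation _ _ (isDeflation_biprod_map_id M hp) h₁
  have e : biprod.map (𝟙 M) p ≫ biprod.desc f (𝟙 X) = biprod.desc f p := by ext <;> simp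
  rwa [e] at this

end Biproducts

end Conflations

/-! ### Connecting morphisms of conflations -/

section Connecting

variable {E : Type u} [Category.{v} E] [Preadditive E] {𝓔 : ExactStructure E}
  [h𝓔 : 𝓔.IsFrobenius]

/-- `c : D ⟶ S A` is a connecting morphism of the conflation `A ⟶ B ⟶ D`. -/
def IsConnecting (𝓔 : ExactStructure E) [𝓔.IsFrobenius] {A B D : E} (i : A ⟶ B) (p : B ⟶ D)
    (c : D ⟶ 𝓔.cosyzygy A) : Prop :=
  ∃ g : B ⟶ 𝓔.hull A, i ≫ g = 𝓔.toHull A ∧ p ≫ c = g ≫ 𝓔.fromHull A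

lemma isConnecting_hull (A : E) : 𝓔.IsConnecting (𝓔.toHull A) (𝓔.fromHull A) (𝟙 _) :=
  ⟨𝟙 _, by simp, by simp⟩

lemma hull_projective (A : E) : 𝓔.IsProjective (𝓔.hull A) :=
  (h𝓔.projective_iff_injective _).2 (𝓔.hull_injective A)

/-- `f : X ⟶ S A` factors through `I A ⟶ S A`, that is, the class of `f` in `Ext¹(X, A)`
vanishes. -/
def ExtZero {X A : E} (f : X ⟶ 𝓔.cosyzygy A) : Prop := ∃ g, g ≫ 𝓔.fromHull A = f

lemma extZero_iff {X A : E} (f : X ⟶ 𝓔.cosyzygy A) :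
    ExtZero f ↔ 𝓔.FactorsThroughProjective f := by
  constructor
  · rintro ⟨g, hg⟩
    exact ⟨_, g, _, hull_projective A, hg⟩
  · rintro ⟨P, a, b, hP, rfl⟩
    obtain ⟨g, hg⟩ := hP _ _ (𝓔.hull_conflation A) b
    exact ⟨a ≫ g, by rw [Category.assoc, hg]⟩

namespace IsConflation

variable {A B D : E} {i : A ⟶ B} {p : B ⟶ D} (h : 𝓔.IsConflation i p)

include h

lemma exists_isConnecting : ∃ c, 𝓔.IsConnecting i p c := by
  obtain ⟨g, hg⟩ := 𝓔.hull_injective A i p h (𝓔.toHull A)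
  obtain ⟨c, hc⟩ := h.exists_lift (g ≫ 𝓔.fromHull A) (by
    rw [← Category.assoc, hg, (𝓔.hull_conflation A).zero])
  exact ⟨c, g, hg, hc⟩

variable {c : D ⟶ 𝓔.cosyzygy A} (hc : 𝓔.IsConnecting i p c)

include hc

/-- Exactness of Hom(X, B) → Hom(X, D) → Ext¹(X, A). -/
lemma extZero_comp_iff {X : E} (f : X ⟶ D) : ExtZero (f ≫ c) ↔ ∃ l, l ≫ p = f := by
  obtain ⟨g, hg₁, hg₂⟩ := hc
  constructor
  · rintro ⟨x, hx⟩
    -- When the class is trivial, the conflation pulled back along f has a retraction s of i'.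
    -- Removing the A-component, f' - s ≫ i descends to the required lift.
    obtain ⟨B', i', p', f', h', hi', hp'⟩ := h.exists_pullback f
    have := (𝓔.hull_conflation A).mono
    obtain ⟨s, hs⟩ := (𝓔.hull_conflation A).exists_factor (f' ≫ g - p' ≫ x) (by
      rw [Preadditive.sub_comp, Category.assoc, Category.assoc, ← hg₂, hx, ← Category.assoc,
        hp', Category.assoc, sub_self])
    have hs' : i' ≫ s = 𝟙 A := by
      rw [← cancel_mono (𝓔.toHull A), Category.assoc, hs, Preadditive.comp_sub,
        ← Category.assoc, hi', hg₁, ← Category.assoc, h'.zero, zero_comp, sub_zero,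
        Category.id_comp]
    obtain ⟨l, hl⟩ := h'.exists_lift (f' - s ≫ i) (by
      rw [Preadditive.comp_sub, hi', ← Category.assoc, hs', Category.id_comp, sub_self])
    have := h'.epi
    refine ⟨l, ?_⟩
    rw [← cancel_epi p', ← Category.assoc, hl, Preadditive.sub_comp, hp', Category.assoc, h.zero,
      comp_zero, sub_zero]
  · rintro ⟨l, rfl⟩
    exact ⟨l ≫ g, by rw [Category.assoc, Category.assoc, hg₂]⟩

/-- Exactness of Hom(B, N) → Hom(A, N) → Ext¹(D, N), with the connecting map computed by the
suspension of f. -/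
lemma extZero_comp_cosyzygy_iff {N : E} {f : A ⟶ N} {f' : 𝓔.cosyzygy A ⟶ 𝓔.cosyzygy N}
    (hf : 𝓔.IsCosyzygyMap f f') : ExtZero (c ≫ f') ↔ ∃ l, i ≫ l = f := by
  obtain ⟨g, hg₁, hg₂⟩ := hc
  obtain ⟨m, hm₁, hm₂⟩ := hf
  have := h.epi
  have := (𝓔.hull_conflation N).mono
  constructor
  · rintro ⟨x, hx⟩
    obtain ⟨l, hl⟩ := (𝓔.hull_conflation N).exists_factor (g ≫ m - p ≫ x) (by
      rw [Preadditive.sub_comp, Category.assoc, Category.assoc, hx, ← hm₂, ← Category.assoc,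
        ← hg₂, Category.assoc, sub_self])
    refine ⟨l, ?_⟩
    rw [← cancel_mono (𝓔.toHull N), Category.assoc, hl, Preadditive.comp_sub, ← Category.assoc,
      hg₁, hm₁, ← Category.assoc, h.zero, zero_comp, sub_zero]
  · rintro ⟨l, rfl⟩
    obtain ⟨x, hx⟩ := h.exists_lift (g ≫ m - l ≫ 𝓔.toHull N) (by
      rw [Preadditive.comp_sub, ← Category.assoc, hg₁, hm₁, Category.assoc, sub_self])
    refine ⟨x, ?_⟩
    rw [← cancel_epi p, ← Category.assoc, hx, Preadditive.sub_comp, Category.assoc,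
      Category.assoc, (𝓔.hull_conflation N).zero, comp_zero, sub_zero, ← hm₂, ← Category.assoc,
      ← hg₂, Category.assoc]

/-- Exactness of `Hom(A, N) ⟶ Hom(D, S N) ⟶ Hom(B, S N)` in the stable category. -/
lemma exists_extZero_sub_comp_cosyzygy {N : E} (x : D ⟶ 𝓔.cosyzygy N) (hx : ExtZero (p ≫ x)) :
    ∃ f : A ⟶ N, ∀ f', 𝓔.IsCosyzygyMap f f' → ExtZero (x - c ≫ f') := by
  obtain ⟨g, hg₁, hg₂⟩ := hc
  obtain ⟨y, hy⟩ := hx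
  have := h.epi
  obtain ⟨f, hf⟩ := (𝓔.hull_conflation N).exists_factor (i ≫ y) (by
    rw [Category.assoc, hy, ← Category.assoc, h.zero, zero_comp])
  refine ⟨f, fun f' ⟨m, hm₁, hm₂⟩ => ?_⟩
  obtain ⟨z, hz⟩ := h.exists_lift (y - g ≫ m) (by
    rw [Preadditive.comp_sub, ← Category.assoc i g, hg₁, hm₁, hf, sub_self])
  refine ⟨z, ?_⟩
  rw [← cancel_epi p, ← Category.assoc, hz, Preadditive.sub_comp, hy, Category.assoc, ← hm₂,
    ← Category.assoc g, ← hg₂, Category.assoc, Preadditive.comp_sub]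

/-- Exactness of `Hom(N, D) ⟶ Hom(N, S A) ⟶ Hom(N, S B)` in the stable category. -/
lemma exists_extZero_sub_comp {N : E} (x : N ⟶ 𝓔.cosyzygy A)
    {i' : 𝓔.cosyzygy A ⟶ 𝓔.cosyzygy B} (hi : 𝓔.IsCosyzygyMap i i') (hx : ExtZero (x ≫ i')) :
    ∃ y : N ⟶ D, ExtZero (x - y ≫ c) := by
  obtain ⟨g, hg₁, hg₂⟩ := hc
  obtain ⟨m, hm₁, hm₂⟩ := hi
  obtain ⟨u, hu⟩ := hx
  have := (𝓔.hull_conflation B).mono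
  -- B' is the extension of N by A with class x. Triviality after pushing along i extends i to s :
  -- B' → B, and passing to quotients gives y : N → D.
  obtain ⟨B', j, q, x', h', hj, hq⟩ := (𝓔.hull_conflation A).exists_pullback x
  have := h'.epi
  obtain ⟨s, hs⟩ := (𝓔.hull_conflation B).exists_factor (x' ≫ m - q ≫ u) (by
    rw [Preadditive.sub_comp, Category.assoc, Category.assoc, hu, ← hm₂, ← Category.assoc, hq,
      Category.assoc, sub_self])
  have hs' : j ≫ s = i := by
    rw [← cancel_mono (𝓔.toHull B), Category.assoc, hs, Preadditive.comp_sub, ← Category.assoc,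
      hj, hm₁, ← Category.assoc, h'.zero, zero_comp, sub_zero]
  obtain ⟨y, hy⟩ := h'.exists_lift (s ≫ p) (by rw [← Category.assoc, hs', h.zero])
  obtain ⟨z, hz⟩ := h'.exists_lift (x' - s ≫ g) (by
    rw [Preadditive.comp_sub, hj, ← Category.assoc, hs', hg₁, sub_self])
  refine ⟨y, z, ?_⟩
  rw [← cancel_epi q, ← Category.assoc, hz, Preadditive.sub_comp, hq, Category.assoc, ← hg₂,
    ← Category.assoc s, ← hy, Preadditive.comp_sub, Category.assoc]

/-- Going around the square by the hulls or by the conflations gives two extensions to B of the same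
map A → I A'; their difference descends to D. -/
lemma extZero_connecting_naturality {A' B' D' : E} {j : A' ⟶ B'} {q : B' ⟶ D'}
    {e : D' ⟶ 𝓔.cosyzygy A'} (he : 𝓔.IsConnecting j q e) {a : A ⟶ A'} {b : B ⟶ B'} {d : D ⟶ D'}
    (h₁ : i ≫ b = a ≫ j) (h₂ : p ≫ d = b ≫ q) {a' : 𝓔.cosyzygy A ⟶ 𝓔.cosyzygy A'}
    (ha : 𝓔.IsCosyzygyMap a a') : ExtZero (c ≫ a' - d ≫ e) := by
  obtain ⟨g, hg₁, hg₂⟩ := hc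
  obtain ⟨g', hg₁', hg₂'⟩ := he
  obtain ⟨m, hm₁, hm₂⟩ := ha
  have := h.epi
  obtain ⟨z, hz⟩ := h.exists_lift (g ≫ m - b ≫ g') (by
    rw [Preadditive.comp_sub, ← Category.assoc, hg₁, hm₁, ← Category.assoc, h₁, Category.assoc,
      hg₁', sub_self])
  refine ⟨z, ?_⟩
  rw [← cancel_epi p, ← Category.assoc, hz, Preadditive.sub_comp, Preadditive.comp_sub,
    Category.assoc, Category.assoc, ← hm₂, ← hg₂', ← Category.assoc p, hg₂, ← Category.assoc p,
    h₂, Category.assoc, Category.assoc]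

end IsConflation

end Connecting

end ExactStructure

lemma kernel_ι_lift_comp {C : Type*} [Category* C] [HasZeroMorphisms C] [HasKernels C]
    {X Y Z : C} (f : Y ⟶ Z) (g : X ⟶ Y) (h : g ≫ f = 0) :
    kernel.ι (kernel.lift f g h) ≫ g = 0 :=
  (congrArg (kernel.ι _ ≫ ·) (kernel.lift_ι f g h).symm).trans
    (by rw [kernel.condition_assoc, zero_comp])

/-! ### Representable modules and presentations -/

noncomputable section Representables

open Opposite

variable {k : Type t} [Field k] {A : Type u} [Category.{v} A] [Preadditive A] [Linear k A]

namespace LinMod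

/-- The morphism `M^ ⟶ Z` that corresponds to an element of `Z M`. -/
def ofElement {M : A} {Z : LinMod k A} (w : Z.obj.obj (op M)) : (LinMod.yoneda k).obj M ⟶ Z :=
  ObjectProperty.homMk
    { app := fun N => ModuleCat.ofHom
        { toFun := fun x : N.unop ⟶ M => Z.obj.map x.op w
          map_add' := fun x y => by rw [Z.property.1]; rfl
          map_smul' := fun r x => by rw [Z.property.2]; rfl }
      naturality := fun N N' f => by
        ext x
        exact congrArg (fun g => g w) (Z.obj.map_comp x.op f) }

lemma ofElement_app {M N : A} {Z : LinMod k A} (w : Z.obj.obj (op M)) (x : N ⟶ M) :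
    (ofElement w).hom.app (op N) x = Z.obj.map x.op w := rfl

lemma app_eq_map {M N : A} {Z : LinMod k A} (f : (LinMod.yoneda k).obj M ⟶ Z) (x : N ⟶ M) :
    f.hom.app (op N) x = Z.obj.map x.op (f.hom.app (op M) (𝟙 M)) := by
  have := congrArg (fun g => g (𝟙 M)) (congrArg ModuleCat.Hom.hom (f.hom.naturality x.op))
  refine Eq.trans ?_ this
  change f.hom.app (op N) x = f.hom.app (op N) (x ≫ 𝟙 M)
  rw [Category.comp_id]

lemma hom_ext {M : A} {Z : LinMod k A} {f g : (LinMod.yoneda k).obj M ⟶ Z}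
    (h : f.hom.app (op M) (𝟙 M) = g.hom.app (op M) (𝟙 M)) : f = g := by
  ext N x
  exact (app_eq_map f x).trans (by rw [h]; exact (app_eq_map g x).symm)

lemma ofElement_app_id {M : A} {Z : LinMod k A} (w : Z.obj.obj (op M)) :
    (ofElement w).hom.app (op M) (𝟙 M) = w := by
  rw [ofElement_app, op_id, Z.obj.map_id]
  rfl

lemma yoneda_map_comp_ofElement {M N : A} {Z : LinMod k A} (x : N ⟶ M) (w : Z.obj.obj (op M)) :
    (LinMod.yoneda k).map x ≫ ofElement w = ofElement (Z.obj.map x.op w) := by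
  apply hom_ext
  rw [ofElement_app_id]
  change Z.obj.map (𝟙 N ≫ x).op w = _
  rw [Category.id_comp]

lemma ofElement_comp {M : A} {Z Z' : LinMod k A} (w : Z.obj.obj (op M)) (f : Z ⟶ Z') :
    ofElement w ≫ f = ofElement (f.hom.app (op M) w) := by
  apply hom_ext
  rw [ofElement_app_id]
  exact congrArg (f.hom.app (op M)) (ofElement_app_id w)

lemma exists_eq_ofElement {M : A} {Z : LinMod k A} (f : (LinMod.yoneda k).obj M ⟶ Z) :
    ∃ w, f = ofElement w :=
  ⟨_, hom_ext (ofElement_app_id _).symm⟩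

lemma ofElement_injective {M : A} {Z : LinMod k A} {w w' : Z.obj.obj (op M)}
    (h : ofElement w = ofElement w') : w = w' := by
  rw [← ofElement_app_id w, h, ofElement_app_id]

lemma ofElement_eq_zero_iff {M : A} {Z : LinMod k A} (w : Z.obj.obj (op M)) :
    ofElement w = 0 ↔ w = 0 := by
  constructor
  · intro h
    rw [← ofElement_app_id w, h]
    rfl
  · rintro rfl
    apply hom_ext
    rw [ofElement_app_id]
    rfl

instance : (LinMod.yoneda k (A := A)).Full where
  map_surjective {M N} f := by
    refine ⟨f.hom.app (op M) (𝟙 M), hom_ext ?_⟩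
    exact Category.id_comp (obj := A) _

instance : (LinMod.yoneda k (A := A)).Faithful where
  map_injective {M N} f g h := by
    have := congrArg (fun a : (LinMod.yoneda k).obj M ⟶ (LinMod.yoneda k).obj N =>
      a.hom.app (op M) (𝟙 M)) h
    change 𝟙 M ≫ f = 𝟙 M ≫ g at this
    simpa using this

instance : (LinMod.yoneda k (A := A)).Additive where
  map_add {M N f g} := by
    apply hom_ext
    change 𝟙 M ≫ (f + g) = 𝟙 M ≫ f + 𝟙 M ≫ g
    simp

instance : (LinMod.yoneda k (A := A)).Linear k where
  map_smul {M N} f r := by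
    apply hom_ext
    change 𝟙 M ≫ (r • f) = r • (𝟙 M ≫ f)
    simp

lemma epi_of_surjective {Z Z' : LinMod k A} (f : Z ⟶ Z')
    (h : ∀ N : A, Function.Surjective (f.hom.app (op N))) : Epi f := by
  have (N : Aᵒᵖ) : Epi (((isLinearFunctor k A).ι.map f).app N) :=
    (ModuleCat.epi_iff_surjective _).2 (h N.unop)
  have : Epi ((isLinearFunctor k A).ι.map f) := NatTrans.epi_of_epi_app _
  exact (isLinearFunctor k A).ι.epi_of_epi_map this

/-- By Yoneda, morphisms from representables are elements, so they detect surjectivity. -/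
lemma epi_of_lift {Z Z' : LinMod k A} (f : Z ⟶ Z')
    (h : ∀ (N : A) (a : (LinMod.yoneda k).obj N ⟶ Z'), ∃ b, b ≫ f = a) : Epi f := by
  refine epi_of_surjective f fun N y => ?_
  obtain ⟨b, hb⟩ := h N (ofElement y)
  obtain ⟨w, rfl⟩ := exists_eq_ofElement b
  rw [ofElement_comp] at hb
  exact ⟨w, ofElement_injective hb⟩

lemma mono_of_cancel {Z Z' : LinMod k A} (f : Z ⟶ Z')
    (h : ∀ (N : A) (a : (LinMod.yoneda k).obj N ⟶ Z), a ≫ f = 0 → a = 0) : Mono f := by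
  refine Preadditive.mono_of_cancel_zero f fun {X} g hg => ?_
  ext N y
  have e := h N.unop (ofElement y ≫ g) (by rw [Category.assoc, hg, comp_zero])
  rw [ofElement_comp, ofElement_eq_zero_iff] at e
  exact e

lemma surjective_of_epi {Z Z' : LinMod k A} (f : Z ⟶ Z') [Epi f] (N : A) :
    Function.Surjective (f.hom.app (op N)) := by
  have := (isLinearFunctor k A).preservesEpimorphisms_ι_of_isNormalMonoCategory
  have : Epi ((isLinearFunctor k A).ι.map f) := inferInstance
  exact (ModuleCat.epi_iff_surjective _).1 ((NatTrans.epi_iff_epi_app _).1 this (op N))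

instance (M : A) : Projective ((LinMod.yoneda k).obj M) where
  factors {Z Z'} f e _ := by
    obtain ⟨y, rfl⟩ := exists_eq_ofElement f
    obtain ⟨w, rfl⟩ := surjective_of_epi e M y
    exact ⟨ofElement w, ofElement_comp w e⟩

/-- The element `w` of `Z` defines a presentation `M₁^ ⟶ M₀^ ⟶ Z ⟶ 0`. -/
structure IsPresentation {M₁ M₀ : A} (p : M₁ ⟶ M₀) {Z : LinMod k A}
    (w : Z.obj.obj (op M₀)) : Prop where
  exists_map_eq : ∀ {N : A} (y : Z.obj.obj (op N)), ∃ x : N ⟶ M₀, Z.obj.map x.op w = y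
  map_eq_zero_iff : ∀ {N : A} (x : N ⟶ M₀), Z.obj.map x.op w = 0 ↔ ∃ l, l ≫ p = x

namespace IsPresentation

variable {M₁ M₀ : A} {p : M₁ ⟶ M₀} {Z : LinMod k A} {w : Z.obj.obj (op M₀)}
  (h : IsPresentation p w)

include h

lemma exists_comp_eq {N : A} (y : (LinMod.yoneda k).obj N ⟶ Z) :
    ∃ x : N ⟶ M₀, (LinMod.yoneda k).map x ≫ ofElement w = y := by
  obtain ⟨y, rfl⟩ := exists_eq_ofElement y
  obtain ⟨x, rfl⟩ := h.exists_map_eq y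
  exact ⟨x, yoneda_map_comp_ofElement x w⟩

lemma comp_eq_zero_iff {N : A} (x : N ⟶ M₀) :
    (LinMod.yoneda k).map x ≫ ofElement w = 0 ↔ ∃ l, l ≫ p = x := by
  rw [yoneda_map_comp_ofElement, ofElement_eq_zero_iff, h.map_eq_zero_iff]

lemma epi_ofElement : Epi (ofElement w) :=
  epi_of_lift _ fun N a => by
    obtain ⟨x, hx⟩ := h.exists_comp_eq a
    exact ⟨_, hx⟩

lemma zero : (LinMod.yoneda k).map p ≫ ofElement w = 0 :=
  (h.comp_eq_zero_iff p).2 ⟨𝟙 _, Category.id_comp p⟩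

lemma epi_kernel_lift :
    Epi (kernel.lift (ofElement w) ((LinMod.yoneda k).map p) h.zero) := by
  refine epi_of_lift _ fun N a => ?_
  obtain ⟨x, hx⟩ := (LinMod.yoneda k).map_surjective (a ≫ kernel.ι _)
  obtain ⟨l, rfl⟩ := (h.comp_eq_zero_iff x).1 (by
    rw [hx, Category.assoc, kernel.condition, comp_zero])
  refine ⟨(LinMod.yoneda k).map l, ?_⟩
  rw [← cancel_mono (kernel.ι _), Category.assoc, kernel.lift_ι, ← hx, Functor.map_comp]

lemma exact : (ShortComplex.mk _ _ h.zero).Exact :=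
  (ShortComplex.exact_iff_epi_kernel_lift _).2 h.epi_kernel_lift

lemma nonempty_iso : Nonempty (Z ≅ cokernel ((LinMod.yoneda k).map p)) := by
  have := h.epi_ofElement
  exact ⟨(h.exact.gIsCokernel.coconePointUniqueUpToIso (colimit.isColimit _))⟩

omit h in
-- The element w corresponds to the projection from M₀^; projectivity of representables turns the
-- cokernel property into statements about elements.
lemma of_iso (e : Z ≅ cokernel ((LinMod.yoneda k).map p)) :
    ∃ w : Z.obj.obj (op M₀), IsPresentation p w := by
  have hex : (ShortComplex.mk ((LinMod.yoneda k).map p) (cokernel.π ((LinMod.yoneda k).map p) ≫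
      e.inv) (by rw [← Category.assoc, cokernel.condition, zero_comp])).Exact := by
    refine ShortComplex.exact_of_g_is_cokernel _ ?_
    exact CokernelCofork.IsColimit.ofπ' _ _ fun {X} f hf =>
      ⟨e.hom ≫ cokernel.desc _ f hf, by simp⟩
  obtain ⟨w, hw⟩ := exists_eq_ofElement (cokernel.π ((LinMod.yoneda k).map p) ≫ e.inv)
  have hepi : Epi (cokernel.π ((LinMod.yoneda k).map p) ≫ e.inv) := inferInstance
  refine ⟨w, fun {N} y => ?_, fun {N} x => ?_⟩
  · obtain ⟨x, hx⟩ := (LinMod.yoneda k).map_surjective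
      (Projective.factorThru (ofElement y) (cokernel.π ((LinMod.yoneda k).map p) ≫ e.inv))
    refine ⟨x, ofElement_injective ?_⟩
    rw [← yoneda_map_comp_ofElement, hx, ← hw, Projective.factorThru_comp]
  · rw [← ofElement_eq_zero_iff, ← yoneda_map_comp_ofElement, ← hw]
    constructor
    · intro hx
      obtain ⟨l, hl⟩ := (LinMod.yoneda k).map_surjective
        (hex.liftFromProjective ((LinMod.yoneda k).map x) hx)
      refine ⟨l, (LinMod.yoneda k).map_injective ?_⟩
      rw [Functor.map_comp, hl]
      exact hex.liftFromProjective_comp _ hx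
    · rintro ⟨l, rfl⟩
      simp

end IsPresentation

/-! ### Resolutions by representable modules -/

section Resolution

variable {M₃ M₂ M₁ M₀ : A} {m : M₃ ⟶ M₂} {d : M₂ ⟶ M₁} {p : M₁ ⟶ M₀} {Z : LinMod k A}
  {w : Z.obj.obj (op M₀)}

lemma mono_yoneda_map (hm : ∀ {N : A} (x : N ⟶ M₃), x ≫ m = 0 → x = 0) :
    Mono ((LinMod.yoneda k).map m) := by
  refine mono_of_cancel _ fun N a ha => ?_
  obtain ⟨x, rfl⟩ := (LinMod.yoneda k).map_surjective a
  rw [← Functor.map_comp] at ha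
  rw [hm x ((LinMod.yoneda k).map_injective (by rw [ha, Functor.map_zero])), Functor.map_zero]

/-- The projective resolution `0 ⟶ M₃^ ⟶ M₂^ ⟶ M₁^ ⟶ M₀^ ⟶ Z ⟶ 0` that extends a presentation
of `Z`. -/
def resolution (hw : IsPresentation p w)
    (h₂ : ∀ {N : A} (x : N ⟶ M₁), x ≫ p = 0 ↔ ∃ l, l ≫ d = x)
    (h₃ : ∀ {N : A} (x : N ⟶ M₂), x ≫ d = 0 ↔ ∃ l, l ≫ m = x)
    (hm : ∀ {N : A} (x : N ⟶ M₃), x ≫ m = 0 → x = 0) :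
    LengthThreeResolution ((LinMod.yoneda k).obj M₃) ((LinMod.yoneda k).obj M₂)
      ((LinMod.yoneda k).obj M₁) ((LinMod.yoneda k).obj M₀) Z :=
  have hdp : d ≫ p = 0 := (h₂ d).2 ⟨𝟙 _, Category.id_comp d⟩
  have hmd : m ≫ d = 0 := (h₃ m).2 ⟨𝟙 _, Category.id_comp m⟩
  have e₁ : (LinMod.yoneda k).map d ≫
      kernel.lift (ofElement w) ((LinMod.yoneda k).map p) hw.zero = 0 := by
    rw [← cancel_mono (kernel.ι _), Category.assoc, kernel.lift_ι, ← Functor.map_comp, hdp,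
      Functor.map_zero, zero_comp]
  have e₂ : (LinMod.yoneda k).map m ≫ kernel.lift _ ((LinMod.yoneda k).map d) e₁ = 0 := by
    rw [← cancel_mono (kernel.ι _), Category.assoc, kernel.lift_ι, ← Functor.map_comp, hmd,
      Functor.map_zero, zero_comp]
  have := hw.epi_ofElement
  have := hw.epi_kernel_lift
  have := mono_yoneda_map (k := k) hm
  have : Epi (kernel.lift _ ((LinMod.yoneda k).map d) e₁) := epi_of_lift _ fun N a => by
    obtain ⟨x, hx⟩ := (LinMod.yoneda k).map_surjective (a ≫ kernel.ι _)
    obtain ⟨l, rfl⟩ := (h₂ x).1 ((LinMod.yoneda k).map_injective (by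
      rw [Functor.map_comp, hx, Functor.map_zero,
        Category.assoc, kernel_ι_lift_comp, comp_zero]))
    exact ⟨(LinMod.yoneda k).map l, by
      rw [← cancel_mono (kernel.ι _), Category.assoc, kernel.lift_ι, ← hx, Functor.map_comp]⟩
  have : Epi (kernel.lift _ ((LinMod.yoneda k).map m) e₂) := epi_of_lift _ fun N a => by
    obtain ⟨x, hx⟩ := (LinMod.yoneda k).map_surjective (a ≫ kernel.ι _)
    obtain ⟨l, rfl⟩ := (h₃ x).1 ((LinMod.yoneda k).map_injective (by
      rw [Functor.map_comp, hx, Functor.map_zero,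
        Category.assoc, kernel_ι_lift_comp, comp_zero]))
    exact ⟨(LinMod.yoneda k).map l, by
      rw [← cancel_mono (kernel.ι _), Category.assoc, kernel.lift_ι, ← hx, Functor.map_comp]⟩
  { Ω := kernel (ofElement w)
    K := kernel (kernel.lift (ofElement w) ((LinMod.yoneda k).map p) hw.zero)
    d₃ := (LinMod.yoneda k).map m
    q₂ := kernel.lift _ ((LinMod.yoneda k).map d) e₁
    i₁ := kernel.ι _
    q₁ := kernel.lift _ ((LinMod.yoneda k).map p) hw.zero
    i₀ := kernel.ι _
    π := ofElement w
    zero₃ := e₂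
    zero₂ := kernel.condition _
    zero₁ := kernel.condition _
    exact₃ := .mk' ((ShortComplex.exact_iff_epi_kernel_lift _).2 ‹_›) ‹_› ‹_›
    exact₂ := .mk' (ShortComplex.exact_kernel _) inferInstance ‹_›
    exact₁ := .mk' (ShortComplex.exact_kernel _) inferInstance ‹_› }

variable (hw : IsPresentation p w)
  (h₂ : ∀ {N : A} (x : N ⟶ M₁), x ≫ p = 0 ↔ ∃ l, l ≫ d = x)
  (h₃ : ∀ {N : A} (x : N ⟶ M₂), x ≫ d = 0 ↔ ∃ l, l ≫ m = x)
  (hm : ∀ {N : A} (x : N ⟶ M₃), x ≫ m = 0 → x = 0)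

lemma resolution_d₁ : (resolution hw h₂ h₃ hm).d₁ = (LinMod.yoneda k).map p :=
  kernel.lift_ι _ _ _

lemma resolution_d₂ : (resolution hw h₂ h₃ hm).d₂ = (LinMod.yoneda k).map d :=
  kernel.lift_ι _ _ _

end Resolution

end LinMod

end Representables

namespace ExactStructure

/-! ### The suspension functor is fully faithful -/

section Stable

variable {E : Type u} [Category.{v} E] [Preadditive E] [HasFiniteBiproducts E]
  {𝓔 : ExactStructure E}

lemma toStable_map_eq_zero_iff {X Y : E} (f : X ⟶ Y) :
    𝓔.toStable.map f = 0 ↔ 𝓔.FactorsThroughProjective f := by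
  rw [← 𝓔.toStable.map_zero, Quotient.functor_map_eq_iff]
  simp [stableRel]

variable [h𝓔 : 𝓔.IsFrobenius]

lemma toStable_map_eq_zero_iff_extZero {X A : E} (f : X ⟶ 𝓔.cosyzygy A) :
    𝓔.toStable.map f = 0 ↔ ExtZero f := by
  rw [toStable_map_eq_zero_iff, extZero_iff]

lemma ExtZero.toStable_map_eq {X A : E} {f g : X ⟶ 𝓔.cosyzygy A} (h : ExtZero (f - g)) :
    𝓔.toStable.map f = 𝓔.toStable.map g := by
  rw [← sub_eq_zero, ← Functor.map_sub, toStable_map_eq_zero_iff_extZero]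
  exact h

lemma suspension_map {X Y : E} {f : X ⟶ Y} {f' : 𝓔.cosyzygy X ⟶ 𝓔.cosyzygy Y}
    (h : 𝓔.IsCosyzygyMap f f') :
    𝓔.suspension.map (𝓔.toStable.map f) = 𝓔.toStable.map f' :=
  IsCosyzygyMap.stable_eq 𝓔 (𝓔.exists_isCosyzygyMap f).choose_spec h
    (Congruence.equivalence.refl _)

instance : 𝓔.suspension.Additive where
  map_add {X Y f g} := by
    obtain ⟨f, rfl⟩ := 𝓔.toStable.map_surjective (X := X.as) (Y := Y.as) f
    obtain ⟨g, rfl⟩ := 𝓔.toStable.map_surjective (X := X.as) (Y := Y.as) g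
    obtain ⟨f', hf⟩ := 𝓔.exists_isCosyzygyMap f
    obtain ⟨g', hg⟩ := 𝓔.exists_isCosyzygyMap g
    refine Eq.trans ?_ (congrArg₂ (· + ·) (suspension_map hf) (suspension_map hg)).symm
    obtain ⟨a, ha, ha'⟩ := hf
    obtain ⟨b, hb, hb'⟩ := hg
    exact suspension_map (f := f + g) (f' := f' + g')
      ⟨a + b, by simp [ha, hb], by simp [ha', hb']⟩

instance (k : Type t) [Field k] [Linear k E] : 𝓔.suspension.Linear k where
  map_smul {X Y} f r := by
    obtain ⟨f, rfl⟩ := 𝓔.toStable.map_surjective (X := X.as) (Y := Y.as) f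
    obtain ⟨f', hf⟩ := 𝓔.exists_isCosyzygyMap f
    refine Eq.trans ?_ (congrArg (r • ·) (suspension_map hf)).symm
    obtain ⟨a, ha, ha'⟩ := hf
    exact suspension_map (f := r • f) (f' := r • f') ⟨r • a, by simp [ha], by simp [ha']⟩

instance : 𝓔.suspension.Faithful where
  map_injective {X Y f g} h := by
    obtain ⟨f, rfl⟩ := 𝓔.toStable.map_surjective (X := X.as) (Y := Y.as) f
    obtain ⟨g, rfl⟩ := 𝓔.toStable.map_surjective (X := X.as) (Y := Y.as) g
    rw [← sub_eq_zero, ← Functor.map_sub, ← Functor.map_sub] at h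
    rw [← sub_eq_zero, ← Functor.map_sub, toStable_map_eq_zero_iff]
    obtain ⟨d, hd⟩ := 𝓔.exists_isCosyzygyMap (f - g)
    have h' := (toStable_map_eq_zero_iff_extZero d).1 ((suspension_map hd).symm.trans h)
    -- The hull conflation has the identity as connecting morphism, so the suspension of f - g
    -- vanishes only if f - g extends over the injective hull, which is projective.
    rw [← Category.id_comp d,
      (𝓔.hull_conflation X.as).extZero_comp_cosyzygy_iff (isConnecting_hull _) hd] at h'
    obtain ⟨l, hl⟩ := h'
    exact ⟨_, _, l, hull_projective _, hl⟩

instance : 𝓔.suspension.Full where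
  map_surjective {X Y} x := by
    obtain ⟨x, rfl⟩ := 𝓔.toStable.map_surjective (X := 𝓔.cosyzygy X.as) (Y := 𝓔.cosyzygy Y.as) x
    obtain ⟨f, hf⟩ := (𝓔.hull_conflation X.as).exists_extZero_sub_comp_cosyzygy
      (isConnecting_hull _) x
      ((extZero_iff _).2 ⟨_, 𝟙 _, _, hull_projective _, Category.id_comp _⟩)
    obtain ⟨f', hf'⟩ := 𝓔.exists_isCosyzygyMap f
    refine ⟨𝓔.toStable.map f, ?_⟩
    rw [suspension_map hf']
    have := (hf f' hf').toStable_map_eq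
    rw [Category.id_comp] at this
    exact this.symm

end Stable

/-! ### Cluster tilting subcategories -/

section ClusterTilting

variable {E : Type u} [Category.{v} E] [Preadditive E] [HasFiniteBiproducts E]
  {𝓔 : ExactStructure E} [h𝓔 : 𝓔.IsFrobenius] {T : ObjectProperty 𝓔.StableCategory}
  (hT : IsClusterTilting 𝓔.suspension T)

include hT

lemma extZero_of_isClusterTilting {N M : E} (hN : 𝓔.preimage T N) (hM : 𝓔.preimage T M)
    (f : N ⟶ 𝓔.cosyzygy M) : ExtZero f :=
  (toStable_map_eq_zero_iff_extZero f).1 (hT.rigid _ _ hN hM (𝓔.toStable.map f))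

lemma preimage_of_extZero {X : E}
    (h : ∀ (N : E) (f : N ⟶ 𝓔.cosyzygy X), 𝓔.preimage T N → ExtZero f) : 𝓔.preimage T X := by
  refine hT.maximal _ fun N hN f => ?_
  obtain ⟨f, rfl⟩ := 𝓔.toStable.map_surjective (X := N.as) (Y := 𝓔.cosyzygy X) f
  exact (toStable_map_eq_zero_iff_extZero f).2 (h N.as f hN)

lemma preimage_of_isProjective {P : E} (hP : 𝓔.IsProjective P) : 𝓔.preimage T P := by
  refine preimage_of_extZero hT fun N f _ => ?_
  -- P is injective, so its hull conflation splits and every map to SP factors through I P.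
  obtain ⟨r, hr⟩ := (h𝓔.projective_iff_injective P).1 hP _ _ (𝓔.hull_conflation P) (𝟙 P)
  obtain ⟨s, hs⟩ := (𝓔.hull_conflation P).exists_lift (𝟙 _ - r ≫ 𝓔.toHull P) (by
    rw [Preadditive.comp_sub, ← Category.assoc, hr, Category.comp_id, Category.id_comp, sub_self])
  have := (𝓔.hull_conflation P).epi
  have hs' : s ≫ 𝓔.fromHull P = 𝟙 _ := by
    rw [← cancel_epi (𝓔.fromHull P), ← Category.assoc, hs, Preadditive.sub_comp,
      Category.assoc, (𝓔.hull_conflation P).zero, comp_zero, sub_zero, Category.id_comp,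
      Category.comp_id]
  exact ⟨f ≫ s, by rw [Category.assoc, hs', Category.comp_id]⟩

/-- T is not assumed closed under isomorphism; maximality supplies this. -/
lemma preimage_of_stable_iso {X Y : E} (e : 𝓔.toStable.obj X ≅ 𝓔.toStable.obj Y)
    (hX : 𝓔.preimage T X) : 𝓔.preimage T Y := by
  refine hT.maximal _ fun N hN f => ?_
  rw [← cancel_mono (𝓔.suspension.map e.inv), zero_comp]
  exact hT.rigid _ _ hN hX _

lemma preimage_biprod [HasBinaryBiproducts E] {M P : E} (hM : 𝓔.preimage T M)
    (hP : 𝓔.IsProjective P) :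
    𝓔.preimage T (M ⊞ P) := by
  refine preimage_of_stable_iso hT ⟨𝓔.toStable.map biprod.inl, 𝓔.toStable.map biprod.fst, ?_, ?_⟩
    hM
  · rw [← Functor.map_comp, biprod.inl_fst, 𝓔.toStable.map_id]
  · rw [← Functor.map_comp, ← 𝓔.toStable.map_id, ← sub_eq_zero, ← Functor.map_sub,
      toStable_map_eq_zero_iff]
    refine ⟨P, -biprod.snd, biprod.inr, hP, ?_⟩
    rw [Preadditive.neg_comp, neg_eq_iff_add_eq_zero, add_sub, add_comm (biprod.snd ≫ _),
      biprod.total, sub_self]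

/-- Deflations onto `M₀` with kernel in `M` are surjective on morphisms from objects of `M`. -/
lemma exists_lift_of_preimage {X M₁ M₀ N : E} {i : M₁ ⟶ M₀} {p : M₀ ⟶ X}
    (h : 𝓔.IsConflation i p) (hM₁ : 𝓔.preimage T M₁) (hN : 𝓔.preimage T N) (f : N ⟶ X) :
    ∃ l, l ≫ p = f := by
  obtain ⟨c, hc⟩ := h.exists_isConnecting
  exact (h.extZero_comp_iff hc f).1 (extZero_of_isClusterTilting hT hN hM₁ _)

lemma exists_conflation_of_isClusterTilting (X : E) :
    ∃ (M₁ M₀ : E) (i : M₁ ⟶ M₀) (p : M₀ ⟶ X),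
      𝓔.preimage T M₁ ∧ 𝓔.preimage T M₀ ∧ 𝓔.IsConflation i p := by
  have := hasBinaryBiproducts_of_finite_biproducts E
  obtain ⟨T₀, f, hT₀, hf⟩ := hT.contravariantly_finite (𝓔.toStable.obj X)
  obtain ⟨f, rfl⟩ := 𝓔.toStable.map_surjective (X := T₀.as) f
  obtain ⟨_, P, _, q, hP, hq⟩ := h𝓔.enough_projectives X
  obtain ⟨M₁, i, h⟩ := exists_isConflation (isDeflation_biprod_desc f hq.isDeflation)
  have hM₀ : 𝓔.preimage T (T₀.as ⊞ P) := preimage_biprod hT hT₀ hP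
  refine ⟨M₁, _, i, _, preimage_of_extZero hT fun N x hN => ?_, hM₀, h⟩
  obtain ⟨c, hc⟩ := h.exists_isConnecting
  obtain ⟨i', hi'⟩ := 𝓔.exists_isCosyzygyMap i
  -- Rigidity for the middle term reduces x to y ≫ c. The approximation factors y stably through the
  -- deflation, after which the connecting morphism kills it.
  obtain ⟨y, hy⟩ := h.exists_extZero_sub_comp hc x hi' (extZero_of_isClusterTilting hT hN hM₀ _)
  obtain ⟨l, hl⟩ := hf _ (𝓔.toStable.map y) hN
  obtain ⟨l, rfl⟩ := 𝓔.toStable.map_surjective (X := N) (Y := T₀.as) l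
  rw [← toStable_map_eq_zero_iff_extZero, hy.toStable_map_eq, Functor.map_comp, ← hl]
  have := (h.extZero_comp_iff hc ((l ≫ biprod.inl) ≫ biprod.desc f q)).2 ⟨_, rfl⟩
  rw [← toStable_map_eq_zero_iff_extZero] at this
  simpa using this

end ClusterTilting

/-! ### Modules that vanish on the projective objects -/

section Modules

open Opposite

variable {k : Type t} [Field k] {E : Type u} [Category.{v} E] [Preadditive E] [Linear k E]
  [HasFiniteBiproducts E] {𝓔 : ExactStructure E} [h𝓔 : 𝓔.IsFrobenius]

lemma ext1_π_surjective (K X : E) : Function.Surjective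
    ((cokernel.π ((linearYoneda k E).map (𝓔.fromHull K))).app (op X)) :=
  (ModuleCat.epi_iff_surjective _).1 inferInstance

lemma ext1_π_eq_zero_iff (K : E) {X : E} (x : X ⟶ 𝓔.cosyzygy K) :
    (cokernel.π ((linearYoneda k E).map (𝓔.fromHull K))).app (op X) x = 0 ↔ ExtZero x := by
  have := (ShortComplex.exact_cokernel ((linearYoneda k E).map (𝓔.fromHull K))).map
    ((evaluation Eᵒᵖ (ModuleCat.{v} k)).obj (op X))
  rw [ShortComplex.moduleCat_exact_iff] at this
  constructor
  · intro h
    obtain ⟨g, hg⟩ := this x h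
    exact ⟨g, hg⟩
  · rintro ⟨g, rfl⟩
    exact congrArg (fun a => a.hom g) (congrArg (fun a => a.app (op X))
      (cokernel.condition ((linearYoneda k E).map (𝓔.fromHull K))))

variable {T : ObjectProperty 𝓔.StableCategory} (hT : IsClusterTilting 𝓔.suspension T)

variable (k 𝓔 T) in
/-- The functor `Ext¹(?, K)`, restricted to the preimage of `T`. -/
noncomputable def ext1Restricted (K : E) : LinMod k (𝓔.preimage T).FullSubcategory :=
  ⟨(𝓔.preimage T).ι.op ⋙ 𝓔.ext1 k K, by
    have h₀ : isLinearFunctor k E ((linearYoneda k E).obj (𝓔.cosyzygy K)) :=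
      ((LinMod.yoneda k).obj (𝓔.cosyzygy K)).property
    have h : isLinearFunctor k E (cokernel ((linearYoneda k E).map (𝓔.fromHull K))) :=
      (isLinearFunctor k E).prop_of_epi (cokernel.π ((linearYoneda k E).map (𝓔.fromHull K))) h₀
    exact ⟨fun X Y f g => h.1 _ _ f.hom g.hom, fun X Y f r => h.2 _ _ f.hom r⟩⟩

include hT

/-- The presenting element is the class of the conflation itself. Rigidity gives Ext¹(N, M₁) = 0, so
every element of Ext¹(N, K) is pulled back from it. -/
lemma exists_isPresentation_ext1 {K : E} {M₁ M₀ : (𝓔.preimage T).FullSubcategory}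
    {i : K ⟶ M₁.obj} {p : M₁ ⟶ M₀} (h : 𝓔.IsConflation i p.hom) :
    ∃ w : (ext1Restricted k 𝓔 T K).obj.obj (op M₀), LinMod.IsPresentation p w := by
  obtain ⟨c, hc⟩ := h.exists_isConnecting
  let π := cokernel.π ((linearYoneda k E).map (𝓔.fromHull K))
  have hw {N : (𝓔.preimage T).FullSubcategory} (x : N ⟶ M₀) :
      (ext1Restricted k 𝓔 T K).obj.map x.op (π.app (op M₀.obj) c) =
        π.app (op N.obj) (x.hom ≫ c) :=
    (congrArg (fun a => a.hom c) (π.naturality x.hom.op)).symm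
  refine ⟨π.app (op M₀.obj) c, fun {N} y => ?_, fun {N} x => ?_⟩
  · obtain ⟨y, rfl⟩ := ext1_π_surjective K N.obj y
    obtain ⟨i', hi'⟩ := 𝓔.exists_isCosyzygyMap i
    obtain ⟨x, hx⟩ := h.exists_extZero_sub_comp hc y hi'
      (extZero_of_isClusterTilting hT N.property M₁.property _)
    refine ⟨ObjectProperty.homMk x, (hw _).trans (Eq.symm ?_)⟩
    rw [← ext1_π_eq_zero_iff (k := k)] at hx
    exact sub_eq_zero.1 ((map_sub ((π.app (op N.obj)).hom) y (x ≫ c)).symm.trans hx)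
  · rw [hw]
    refine (ext1_π_eq_zero_iff K _).trans ((h.extZero_comp_iff hc x.hom).trans ?_)
    exact ⟨fun ⟨l, hl⟩ => ⟨ObjectProperty.homMk l, ObjectProperty.hom_ext _ hl⟩,
      fun ⟨l, hl⟩ => ⟨l.hom, congrArg (·.hom) hl⟩⟩

lemma nonempty_iso_ext1 {Z : LinMod k (𝓔.preimage T).FullSubcategory} {K : E}
    {M₁ M₀ : (𝓔.preimage T).FullSubcategory} {i : K ⟶ M₁.obj} {p : M₁ ⟶ M₀}
    (h : 𝓔.IsConflation i p.hom) (hZ : Nonempty (Z ≅ cokernel ((LinMod.yoneda k).map p))) :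
    Nonempty (Z.obj ≅ (𝓔.preimage T).ι.op ⋙ 𝓔.ext1 k K) := by
  obtain ⟨e⟩ := hZ
  obtain ⟨w, hw⟩ := exists_isPresentation_ext1 (k := k) hT h
  obtain ⟨e'⟩ := hw.nonempty_iso
  exact ⟨(isLinearFunctor k _).ι.mapIso (e ≪≫ e'.symm)⟩

lemma isZero_iff_exists_conflation {Z : LinMod k (𝓔.preimage T).FullSubcategory}
    (hZ : LinMod.isFinitelyPresented k (𝓔.preimage T).FullSubcategory Z) :
    (∀ P : (𝓔.preimage T).FullSubcategory, 𝓔.IsProjective P.obj → IsZero (Z.obj.obj (op P))) ↔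
      ∃ (K : E) (M₁ M₀ : (𝓔.preimage T).FullSubcategory) (i : K ⟶ M₁.obj) (p : M₁ ⟶ M₀),
        𝓔.IsConflation i p.hom ∧ Nonempty (Z ≅ cokernel ((LinMod.yoneda k).map p)) := by
  have := hasBinaryBiproducts_of_finite_biproducts E
  constructor
  · intro h
    obtain ⟨M₁, M₀, f, ⟨e⟩⟩ := hZ
    obtain ⟨w, hw⟩ := LinMod.IsPresentation.of_iso e
    obtain ⟨_, P, _, q, hP, hq⟩ := h𝓔.enough_projectives M₀.obj
    let P' : (𝓔.preimage T).FullSubcategory := ⟨P, preimage_of_isProjective hT hP⟩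
    let q' : P' ⟶ M₀ := ObjectProperty.homMk q
    have := ModuleCat.subsingleton_of_isZero (h P' hP)
    -- Z vanishes at P, so the projective cover q of M₀ already factors through f. Adding P to M₁
    -- therefore makes f a deflation without changing the image.
    obtain ⟨ξ, hξ⟩ := (hw.map_eq_zero_iff q').1 (Subsingleton.elim _ _)
    let M : (𝓔.preimage T).FullSubcategory :=
      ⟨M₁.obj ⊞ P, preimage_biprod hT M₁.property hP⟩
    obtain ⟨K, i, hi⟩ := exists_isConflation (isDeflation_biprod_desc f.hom hq.isDeflation)
    let p : M ⟶ M₀ := ObjectProperty.homMk (biprod.desc f.hom q)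
    have hp : LinMod.IsPresentation p w := by
      refine ⟨hw.exists_map_eq, fun {N} x => (hw.map_eq_zero_iff x).trans ⟨?_, ?_⟩⟩
      · rintro ⟨l, rfl⟩
        refine ⟨ObjectProperty.homMk (l.hom ≫ biprod.inl), ?_⟩
        ext
        simp [p]
      · rintro ⟨l, rfl⟩
        have hq : q = ξ.hom ≫ f.hom := (congrArg (·.hom) hξ).symm
        refine ⟨ObjectProperty.homMk (l.hom ≫ biprod.desc (𝟙 _) ξ.hom), ?_⟩
        ext
        simp only [p, hq, ObjectProperty.FullSubcategory.comp_hom, ObjectProperty.homMk_hom,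
          Category.assoc]
        congr 1
        ext <;> simp
    exact ⟨K, M, M₀, i, p, hi, hp.nonempty_iso⟩
  · rintro ⟨K, M₁, M₀, i, p, h, ⟨e⟩⟩ P hP
    obtain ⟨w, hw⟩ := LinMod.IsPresentation.of_iso e
    have : Subsingleton (Z.obj.obj (op P)) := by
      refine subsingleton_of_forall_eq 0 fun y => ?_
      obtain ⟨x, rfl⟩ := hw.exists_map_eq y
      obtain ⟨l, hl⟩ := hP _ _ h x.hom
      exact (hw.map_eq_zero_iff x).2 ⟨ObjectProperty.homMk l, ObjectProperty.hom_ext _ hl⟩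
    exact ModuleCat.isZero_of_subsingleton _

/-- The presentation of a stable module over the preimage of `T`. -/
lemma exists_isPresentation_restrict {Z : LinMod k T.FullSubcategory}
    (hZ : LinMod.isFinitelyPresented k T.FullSubcategory Z) :
    ∃ (K : E) (M₁ M₀ : (𝓔.preimage T).FullSubcategory) (i : K ⟶ M₁.obj) (p : M₁ ⟶ M₀)
      (w : ((LinMod.restrict k (𝓔.projection T)).obj Z).obj.obj (op M₀)),
      𝓔.IsConflation i p.hom ∧ LinMod.IsPresentation p w := by
  have := hasBinaryBiproducts_of_finite_biproducts E
  obtain ⟨T₁, T₀, f, ⟨e⟩⟩ := hZ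
  obtain ⟨w, hw⟩ := LinMod.IsPresentation.of_iso e
  obtain ⟨f, rfl⟩ := (ObjectProperty.fullyFaithfulι T).homEquiv.symm.surjective f
  obtain ⟨f, rfl⟩ := 𝓔.toStable.map_surjective (X := T₁.obj.as) (Y := T₀.obj.as) f
  let M₀ : (𝓔.preimage T).FullSubcategory := ⟨T₀.obj.as, T₀.property⟩
  obtain ⟨_, P, _, q, hP, hq⟩ := h𝓔.enough_projectives M₀.obj
  let M₁ : (𝓔.preimage T).FullSubcategory :=
    ⟨T₁.obj.as ⊞ P, preimage_biprod hT T₁.property hP⟩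
  obtain ⟨K, i, hi⟩ := exists_isConflation (isDeflation_biprod_desc f hq.isDeflation)
  -- The summand P adds to the image of f exactly the maps into M₀ that factor through a projective,
  -- since these lift along q.
  let p : M₁ ⟶ M₀ := ObjectProperty.homMk (biprod.desc f q)
  refine ⟨K, M₁, M₀, i, p, w, hi, fun {N} y => ?_, fun {N} x => ?_⟩
  · obtain ⟨x, rfl⟩ := hw.exists_map_eq (N := (𝓔.projection T).obj N) y
    obtain ⟨x', hx⟩ := 𝓔.toStable.map_surjective (X := N.obj) (Y := M₀.obj) x.hom
    have : (𝓔.projection T).map (ObjectProperty.homMk x' : N ⟶ M₀) = x :=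
      ObjectProperty.hom_ext _ hx
    exact ⟨ObjectProperty.homMk x', 
      congrArg (fun a : (𝓔.projection T).obj N ⟶ T₀ => Z.obj.map a.op w) this⟩
  · refine (hw.map_eq_zero_iff ((𝓔.projection T).map x)).trans ⟨?_, ?_⟩
    · rintro ⟨l, hl⟩
      obtain ⟨l', hl'⟩ := 𝓔.toStable.map_surjective (X := N.obj) (Y := T₁.obj.as) l.hom
      have hl : 𝓔.toStable.map (l' ≫ f) = 𝓔.toStable.map x.hom := by
        rw [Functor.map_comp, hl']
        exact congrArg (·.hom) hl
      rw [eq_comm, ← sub_eq_zero, ← Functor.map_sub, toStable_map_eq_zero_iff] at hl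
      obtain ⟨Q, a, b, hQ, hab⟩ := hl
      obtain ⟨b', rfl⟩ := hQ _ _ hq b
      refine ⟨ObjectProperty.homMk (biprod.lift l' (a ≫ b')), ObjectProperty.hom_ext _ ?_⟩
      simp only [p, ObjectProperty.FullSubcategory.comp_hom, ObjectProperty.homMk_hom]
      rw [biprod.lift_desc, Category.assoc, hab, add_sub_cancel]
    · rintro ⟨l, rfl⟩
      refine ⟨ObjectProperty.homMk (𝓔.toStable.map (l.hom ≫ biprod.fst)),
        ObjectProperty.hom_ext _ ?_⟩
      change 𝓔.toStable.map (l.hom ≫ biprod.fst) ≫ 𝓔.toStable.map f =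
        𝓔.toStable.map (l.hom ≫ biprod.desc f q)
      rw [← Functor.map_comp, ← sub_eq_zero, ← Functor.map_sub, toStable_map_eq_zero_iff]
      refine ⟨P, -(l.hom ≫ biprod.snd), q, hP, ?_⟩
      rw [biprod.desc_eq]
      simp

end Modules

end ExactStructure

/-! ### Traces of Calabi-Yau categories -/

section Trace

variable {k : Type t} [Field k]

/-- The trace evaluates the duality at the identity. Naturality in Y recovers the whole pairing from
it, and naturality in X becomes cyclicity. -/
lemma IsTwoCalabiYau.exists_trace {C : Type*} [Category* C] [Preadditive C] [Linear k C]
    {S : C ⥤ C} (h : IsTwoCalabiYau k S) :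
    ∃ tr : ∀ X : C, (X ⟶ S.obj (S.obj X)) →ₗ[k] k, (∀ X Y : C, IsPerfectAt (tr X) Y) ∧
      ∀ {X Y : C} (a : X ⟶ Y) (b : Y ⟶ S.obj (S.obj X)),
        tr Y (b ≫ S.map (S.map a)) = tr X (a ≫ b) := by
  obtain ⟨φ⟩ := h
  let tr (X : C) : (X ⟶ S.obj (S.obj X)) →ₗ[k] k :=
    (LinearMap.applyₗ (𝟙 X : X ⟶ X)).comp (φ.iso X X).toLinearMap
  have key {X Y : C} (a : X ⟶ Y) (b : Y ⟶ S.obj (S.obj X)) : tr X (a ≫ b) = φ.iso X Y b a :=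
    (φ.naturality_right X a b (𝟙 X)).trans (congrArg (φ.iso X Y b) (Category.id_comp a))
  refine ⟨tr, fun X Y => ?_, fun {X Y} a b => ?_⟩
  · have e : tracePairing (tr X) Y = (φ.iso X Y).toLinearMap :=
      LinearMap.ext fun b => LinearMap.ext fun a => key a b
    rw [IsPerfectAt, e]
    exact (φ.iso X Y).bijective
  · rw [key a b]
    exact (φ.naturality_left a Y b (𝟙 Y)).trans
      (congrArg (φ.iso X Y b) (Category.comp_id a))

variable {A D : Type*} [Category* A] [Category* D] [HasZeroObject D] [Preadditive D]
  [HasShift D ℤ] [∀ n : ℤ, (shiftFunctor D n).Additive] [Pretriangulated D] [Linear k D]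

/-- The duality on a triangulated subcategory defined by a cyclic family of perfect traces. -/
lemma nonempty_naturalDuality_of_trace (P : ObjectProperty D) [P.IsTriangulated] (F : A ⥤ D)
    (hF : ∀ Z, P (F.obj Z)) (n : ℤ) (tr : ∀ Z : A, (F.obj Z ⟶ (F.obj Z)⟦n⟧) →ₗ[k] k)
    (hperf : ∀ (Z : A) (Y : D), P Y → IsPerfectAt (tr Z) Y)
    (hcyc : ∀ {Z Z' : A} (z : Z ⟶ Z') (a : F.obj Z' ⟶ (F.obj Z)⟦n⟧),
      tr Z' (a ≫ (F.map z)⟦n⟧') = tr Z (F.map z ≫ a)) :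
    Nonempty (NaturalDuality k (P.lift F hF)
      (P.lift F hF ⋙ shiftFunctor P.FullSubcategory n)) := by
  -- The shift of the subcategory is compared with the ambient shift through the commutation
  -- isomorphism of the inclusion.
  let e (Z : A) : ((P.lift F hF).obj Z)⟦n⟧.obj ≅ (F.obj Z)⟦n⟧ :=
    (P.ι.commShiftIso n).app ((P.lift F hF).obj Z)
  have he {Z Z' : A} (z : Z ⟶ Z') :
      (((P.lift F hF).map z)⟦n⟧').hom ≫ (e Z').hom = (e Z).hom ≫ (F.map z)⟦n⟧' :=
    (P.ι.commShiftIso n).hom.naturality ((P.lift F hF).map z)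
  let toHom (Z : A) (Y : P.FullSubcategory) :
      (Y ⟶ ((P.lift F hF).obj Z)⟦n⟧) ≃ₗ[k] (Y.obj ⟶ (F.obj Z)⟦n⟧) :=
    { toFun := fun b => b.hom ≫ (e Z).hom
      map_add' := fun b b' => Preadditive.add_comp _ _ _ b.hom b'.hom _
      map_smul' := fun r b => Linear.smul_comp _ _ _ r b.hom _
      invFun := fun b => ObjectProperty.homMk (b ≫ (e Z).inv)
      left_inv := fun b => by ext; simp
      right_inv := fun b => by simp }
  let fromHom (Z : A) (Y : P.FullSubcategory) :
      ((P.lift F hF).obj Z ⟶ Y) ≃ₗ[k] (F.obj Z ⟶ Y.obj) :=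
    { toFun := fun a => a.hom
      map_add' := fun _ _ => rfl
      map_smul' := fun _ _ => rfl
      invFun := fun a => ObjectProperty.homMk a
      left_inv := fun _ => rfl
      right_inv := fun _ => rfl }
  let iso (Z : A) (Y : P.FullSubcategory) :
      (Y ⟶ ((P.lift F hF).obj Z)⟦n⟧) ≃ₗ[k] Module.Dual k ((P.lift F hF).obj Z ⟶ Y) :=
    (toHom Z Y).trans ((LinearEquiv.ofBijective _ (hperf Z Y.obj Y.property)).trans
      (fromHom Z Y).dualMap)
  have iso_apply (Z : A) (Y : P.FullSubcategory) (b : Y ⟶ ((P.lift F hF).obj Z)⟦n⟧)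
      (a : (P.lift F hF).obj Z ⟶ Y) : iso Z Y b a = tr Z (a.hom ≫ b.hom ≫ (e Z).hom) := rfl
  refine ⟨⟨iso, fun Z Y Y' y b a => ?_, fun {Z Z'} z Y b a => ?_⟩⟩
  · refine (iso_apply _ _ _ _).trans (Eq.trans ?_ (iso_apply _ _ _ _).symm)
    simp
  · refine (iso_apply _ _ _ _).trans (Eq.trans ?_ (iso_apply _ _ _ _).symm)
    have h₁ : (b ≫ (P.lift F hF ⋙ shiftFunctor P.FullSubcategory n).map z).hom ≫ (e Z').hom =
        (b.hom ≫ (e Z).hom) ≫ (F.map z)⟦n⟧' :=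
      (Category.assoc _ _ _).trans ((congrArg (b.hom ≫ ·) (he z)).trans
        (Category.assoc _ _ _).symm)
    rw [h₁, ← Category.assoc, hcyc, ObjectProperty.FullSubcategory.comp_hom, Category.assoc]
    rfl

end Trace

namespace ExactStructure

/-! ### Morphisms to suspensions in the stable category -/

section Suspension

variable {E : Type u} [Category.{v} E] [Preadditive E] [HasFiniteBiproducts E]
  {𝓔 : ExactStructure E} [h𝓔 : 𝓔.IsFrobenius]

/-- The stable class of a morphism `X ⟶ S A` of the exact category. -/
noncomputable def toSuspension {X A : E} (f : X ⟶ 𝓔.cosyzygy A) :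
    𝓔.toStable.obj X ⟶ 𝓔.suspension.obj (𝓔.toStable.obj A) :=
  𝓔.toStable.map f

lemma toSuspension_eq_zero_iff {X A : E} (f : X ⟶ 𝓔.cosyzygy A) :
    toSuspension f = 0 ↔ ExtZero f :=
  toStable_map_eq_zero_iff_extZero f

lemma ExtZero.toSuspension_eq {X A : E} {f g : X ⟶ 𝓔.cosyzygy A} (h : ExtZero (f - g)) :
    toSuspension f = toSuspension g :=
  h.toStable_map_eq

lemma exists_toSuspension_eq {X A : E}
    (f : 𝓔.toStable.obj X ⟶ 𝓔.suspension.obj (𝓔.toStable.obj A)) : ∃ g, toSuspension g = f :=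
  𝓔.toStable.map_surjective (Y := 𝓔.cosyzygy A) f

lemma map_comp_toSuspension {X Y A : E} (f : X ⟶ Y) (g : Y ⟶ 𝓔.cosyzygy A) :
    𝓔.toStable.map f ≫ toSuspension g = toSuspension (f ≫ g) :=
  (𝓔.toStable.map_comp f g).symm

lemma toSuspension_comp {X A B : E} (f : X ⟶ 𝓔.cosyzygy A) {g : A ⟶ B}
    {g' : 𝓔.cosyzygy A ⟶ 𝓔.cosyzygy B} (hg : 𝓔.IsCosyzygyMap g g') :
    toSuspension f ≫ 𝓔.suspension.map (𝓔.toStable.map g) = toSuspension (f ≫ g') := by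
  rw [suspension_map hg]
  exact (𝓔.toStable.map_comp f g').symm

namespace IsConflation

variable {A B D : E} {i : A ⟶ B} {p : B ⟶ D} (h : 𝓔.IsConflation i p)
  {c : D ⟶ 𝓔.cosyzygy A} (hc : 𝓔.IsConnecting i p c)

include h hc

lemma map_comp_connecting_eq_zero_iff {X : E} (f : X ⟶ D) :
    𝓔.toStable.map f ≫ toSuspension c = 0 ↔ ∃ l, l ≫ p = f := by
  rw [map_comp_toSuspension, toSuspension_eq_zero_iff, h.extZero_comp_iff hc]

lemma connecting_comp_map_eq_zero_iff {N : E} (f : A ⟶ N) :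
    toSuspension c ≫ 𝓔.suspension.map (𝓔.toStable.map f) = 0 ↔ ∃ l, i ≫ l = f := by
  obtain ⟨f', hf⟩ := 𝓔.exists_isCosyzygyMap f
  rw [toSuspension_comp _ hf, toSuspension_eq_zero_iff, h.extZero_comp_cosyzygy_iff hc hf]

lemma exists_connecting_comp_eq {N : E} (hB : ∀ f : B ⟶ 𝓔.cosyzygy N, ExtZero f)
    (x : 𝓔.toStable.obj D ⟶ 𝓔.suspension.obj (𝓔.toStable.obj N)) :
    ∃ f : A ⟶ N, toSuspension c ≫ 𝓔.suspension.map (𝓔.toStable.map f) = x := by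
  obtain ⟨x, rfl⟩ := exists_toSuspension_eq x
  obtain ⟨f, hf⟩ := h.exists_extZero_sub_comp_cosyzygy hc x (hB _)
  obtain ⟨f', hf'⟩ := 𝓔.exists_isCosyzygyMap f
  exact ⟨f, by rw [toSuspension_comp _ hf', (hf f' hf').toSuspension_eq]⟩

lemma exists_comp_connecting_eq {N : E} (hB : ∀ f : N ⟶ 𝓔.cosyzygy B, ExtZero f)
    (x : 𝓔.toStable.obj N ⟶ 𝓔.suspension.obj (𝓔.toStable.obj A)) :
    ∃ f : N ⟶ D, 𝓔.toStable.map f ≫ toSuspension c = x := by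
  obtain ⟨x, rfl⟩ := exists_toSuspension_eq x
  obtain ⟨i', hi'⟩ := 𝓔.exists_isCosyzygyMap i
  obtain ⟨y, hy⟩ := h.exists_extZero_sub_comp hc x hi' (hB _)
  exact ⟨y, by rw [map_comp_toSuspension, hy.toSuspension_eq]⟩

lemma connecting_naturality {A' B' D' : E} {j : A' ⟶ B'} {q : B' ⟶ D'}
    {e : D' ⟶ 𝓔.cosyzygy A'} (he : 𝓔.IsConnecting j q e) {a : A ⟶ A'} {b : B ⟶ B'} {d : D ⟶ D'}
    (h₁ : i ≫ b = a ≫ j) (h₂ : p ≫ d = b ≫ q) :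
    toSuspension c ≫ 𝓔.suspension.map (𝓔.toStable.map a) =
      𝓔.toStable.map d ≫ toSuspension e := by
  obtain ⟨a', ha⟩ := 𝓔.exists_isCosyzygyMap a
  rw [toSuspension_comp _ ha, map_comp_toSuspension]
  exact (h.extZero_connecting_naturality hc he h₁ h₂ ha).toSuspension_eq

end IsConflation

end Suspension

/-! ### Resolutions of stable modules -/

section Resolutions

open Opposite DerivedCategory

variable {k : Type t} [Field k] {E : Type u} [Category.{v} E] [Preadditive E] [Linear k E]
  [HasFiniteBiproducts E] {𝓔 : ExactStructure E} [h𝓔 : 𝓔.IsFrobenius]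
  {T : ObjectProperty 𝓔.StableCategory}

/-- Conflations `K ⟶ M₁ ⟶ M₀` and `M₃ ⟶ M₂ ⟶ K`, with chosen connecting morphisms, such that
`M₁^ ⟶ M₀^ ⟶ Z ⟶ 0` is a presentation. -/
structure StableResolution (Z : LinMod k (𝓔.preimage T).FullSubcategory) where
  K : E
  M₃ : (𝓔.preimage T).FullSubcategory
  M₂ : (𝓔.preimage T).FullSubcategory
  M₁ : (𝓔.preimage T).FullSubcategory
  M₀ : (𝓔.preimage T).FullSubcategory
  m : M₃ ⟶ M₂
  q : M₂.obj ⟶ K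
  i : K ⟶ M₁.obj
  p : M₁ ⟶ M₀
  w : Z.obj.obj (op M₀)
  conflation₁ : 𝓔.IsConflation i p.hom
  conflation₂ : 𝓔.IsConflation m.hom q
  isPresentation : LinMod.IsPresentation p w
  c₁ : M₀.obj ⟶ 𝓔.cosyzygy K
  isConnecting₁ : 𝓔.IsConnecting i p.hom c₁
  c₂ : K ⟶ 𝓔.cosyzygy M₃.obj
  isConnecting₂ : 𝓔.IsConnecting m.hom q c₂

variable (hT : IsClusterTilting 𝓔.suspension T)

include hT in
lemma nonempty_stableResolution {Z : LinMod k T.FullSubcategory}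
    (hZ : LinMod.isFinitelyPresented k T.FullSubcategory Z) :
    Nonempty (StableResolution ((LinMod.restrict k (𝓔.projection T)).obj Z)) := by
  obtain ⟨K, M₁, M₀, i, p, w, h, hw⟩ := exists_isPresentation_restrict hT hZ
  obtain ⟨M₃, M₂, m, q, h₃, h₂, h'⟩ := exists_conflation_of_isClusterTilting hT K
  obtain ⟨c₁, hc₁⟩ := h.exists_isConnecting
  obtain ⟨c₂, hc₂⟩ := h'.exists_isConnecting
  exact ⟨⟨K, ⟨M₃, h₃⟩, ⟨M₂, h₂⟩, M₁, M₀, ObjectProperty.homMk m, q, i, p, w, h, h', hw, c₁, hc₁,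
    c₂, hc₂⟩⟩

namespace StableResolution

variable {Z : LinMod k (𝓔.preimage T).FullSubcategory} (R : StableResolution Z)

/-- The differential `M₂ ⟶ M₁`. -/
def d : R.M₂ ⟶ R.M₁ := ObjectProperty.homMk (R.q ≫ R.i)

@[simp]
lemma d_hom : R.d.hom = R.q ≫ R.i := rfl

include hT in
-- A map killed by p comes from K, and rigidity lifts N → K to M₂.
lemma comp_p_eq_zero_iff {N : (𝓔.preimage T).FullSubcategory} (x : N ⟶ R.M₁) :
    x ≫ R.p = 0 ↔ ∃ l, l ≫ R.d = x := by
  constructor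
  · intro hx
    obtain ⟨y, hy⟩ := R.conflation₁.exists_factor x.hom (congrArg (·.hom) hx)
    obtain ⟨l, hl⟩ := exists_lift_of_preimage hT R.conflation₂ R.M₃.property N.property y
    refine ⟨ObjectProperty.homMk l, ObjectProperty.hom_ext _ ?_⟩
    rw [← hy, ← hl]
    simp
  · rintro ⟨l, rfl⟩
    ext
    simp [R.conflation₁.zero]

lemma comp_d_eq_zero_iff {N : (𝓔.preimage T).FullSubcategory} (x : N ⟶ R.M₂) :
    x ≫ R.d = 0 ↔ ∃ l, l ≫ R.m = x := by
  have := R.conflation₁.mono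
  constructor
  · intro hx
    have hx' : x.hom ≫ R.q ≫ R.i = 0 := congrArg (·.hom) hx
    obtain ⟨l, hl⟩ := R.conflation₂.exists_factor x.hom (by
      rw [← cancel_mono R.i, Category.assoc, hx', zero_comp])
    exact ⟨ObjectProperty.homMk l, ObjectProperty.hom_ext _ hl⟩
  · rintro ⟨l, rfl⟩
    ext
    simp [← Category.assoc R.m.hom, R.conflation₂.zero]

lemma eq_zero_of_comp_m {N : (𝓔.preimage T).FullSubcategory} (x : N ⟶ R.M₃)
    (hx : x ≫ R.m = 0) : x = 0 := by
  have := R.conflation₂.mono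
  ext
  rw [← cancel_mono R.m.hom]
  exact (congrArg (·.hom) hx).trans zero_comp.symm

/-- The projective resolution of a stable module. -/
noncomputable def toResolution : LengthThreeResolution ((LinMod.yoneda k).obj R.M₃)
    ((LinMod.yoneda k).obj R.M₂) ((LinMod.yoneda k).obj R.M₁) ((LinMod.yoneda k).obj R.M₀) Z :=
  LinMod.resolution R.isPresentation (R.comp_p_eq_zero_iff hT) R.comp_d_eq_zero_iff
    R.eq_zero_of_comp_m

lemma toResolution_d₃ : (R.toResolution hT).d₃ = (LinMod.yoneda k).map R.m := rfl

lemma toResolution_d₂ : (R.toResolution hT).d₂ = (LinMod.yoneda k).map R.d :=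
  LinMod.resolution_d₂ _ _ _ _

lemma toResolution_d₁ : (R.toResolution hT).d₁ = (LinMod.yoneda k).map R.p :=
  LinMod.resolution_d₁ _ _ _ _

include R in
-- Such a map is a morphism M₀ → N killed by the deflation p, which is an epimorphism.
lemma eq_zero_of_hom_yoneda {N : (𝓔.preimage T).FullSubcategory}
    (f : Z ⟶ (LinMod.yoneda k).obj N) : f = 0 := by
  have := R.isPresentation.epi_ofElement
  have := R.conflation₁.epi
  obtain ⟨x, hx⟩ := (LinMod.yoneda k).map_surjective (LinMod.ofElement R.w ≫ f)
  have h0 : R.p ≫ x = 0 := (LinMod.yoneda k).map_injective (by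
    rw [Functor.map_comp, hx, ← Category.assoc, R.isPresentation.zero, zero_comp,
      Functor.map_zero])
  have hx0 : x = 0 := by
    ext
    rw [← cancel_epi R.p.hom]
    exact (congrArg (·.hom) h0).trans comp_zero.symm
  rw [← cancel_epi (LinMod.ofElement R.w), ← hx, hx0, Functor.map_zero, comp_zero]

lemma exists_eq_d₁_comp {N : (𝓔.preimage T).FullSubcategory}
    (f : (LinMod.yoneda k).obj R.M₁ ⟶ (LinMod.yoneda k).obj N)
    (hf : (R.toResolution hT).d₂ ≫ f = 0) : ∃ g, f = (R.toResolution hT).d₁ ≫ g := by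
  have := R.conflation₂.epi
  obtain ⟨x, rfl⟩ := (LinMod.yoneda k).map_surjective f
  rw [toResolution_d₂, ← Functor.map_comp] at hf
  have h0 : R.d ≫ x = 0 := (LinMod.yoneda k).map_injective (by rw [hf, Functor.map_zero])
  obtain ⟨l, hl⟩ := R.conflation₁.exists_lift x.hom (by
    rw [← cancel_epi R.q, ← Category.assoc, comp_zero]
    exact congrArg (·.hom) h0)
  refine ⟨(LinMod.yoneda k).map (ObjectProperty.homMk l), ?_⟩
  rw [toResolution_d₁, ← Functor.map_comp]
  exact congrArg _ (ObjectProperty.hom_ext _ hl.symm)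

lemma exists_eq_d₂_comp {N : (𝓔.preimage T).FullSubcategory}
    (f : (LinMod.yoneda k).obj R.M₂ ⟶ (LinMod.yoneda k).obj N)
    (hf : (R.toResolution hT).d₃ ≫ f = 0) : ∃ g, f = (R.toResolution hT).d₂ ≫ g := by
  obtain ⟨x, rfl⟩ := (LinMod.yoneda k).map_surjective f
  rw [toResolution_d₃, ← Functor.map_comp] at hf
  have h0 : R.m ≫ x = 0 := (LinMod.yoneda k).map_injective (by rw [hf, Functor.map_zero])
  obtain ⟨y, hy⟩ := R.conflation₂.exists_lift x.hom (congrArg (·.hom) h0)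
  obtain ⟨y', hy'⟩ := 𝓔.exists_isCosyzygyMap y
  -- The induced map K → N extends over M₁ because Ext¹(M₀, N) = 0.
  obtain ⟨l, rfl⟩ := (R.conflation₁.extZero_comp_cosyzygy_iff R.isConnecting₁ hy').1
    (extZero_of_isClusterTilting hT R.M₀.property N.property _)
  refine ⟨(LinMod.yoneda k).map (ObjectProperty.homMk l), ?_⟩
  rw [toResolution_d₂, ← Functor.map_comp]
  refine congrArg _ (ObjectProperty.hom_ext _ ?_)
  rw [← hy]
  simp

/-! ### The trace form on Hom(Z, Z[3]) -/

section Trace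

variable (tr : ∀ X : 𝓔.StableCategory,
  (X ⟶ 𝓔.suspension.obj (𝓔.suspension.obj X)) →ₗ[k] k)

/-- The map `Hom(M₃, N) ⟶ Hom(K, S N)` in the stable category. -/
noncomputable def toStableHom (N : (𝓔.preimage T).FullSubcategory) : (R.M₃ ⟶ N) →ₗ[k]
    (𝓔.toStable.obj R.K ⟶ 𝓔.suspension.obj (𝓔.toStable.obj N.obj)) :=
  Linear.leftComp k _ (toSuspension R.c₂) ∘ₗ
    ((𝓔.preimage T).ι ⋙ 𝓔.toStable ⋙ 𝓔.suspension).mapLinearMap k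

lemma toStableHom_apply {N : (𝓔.preimage T).FullSubcategory} (f : R.M₃ ⟶ N) :
    R.toStableHom N f = toSuspension R.c₂ ≫ 𝓔.suspension.map (𝓔.toStable.map f.hom) := rfl

lemma toStableHom_eq_zero_iff {N : (𝓔.preimage T).FullSubcategory} (f : R.M₃ ⟶ N) :
    R.toStableHom N f = 0 ↔ ∃ g, R.m ≫ g = f := by
  rw [toStableHom_apply,
    R.conflation₂.connecting_comp_map_eq_zero_iff R.isConnecting₂]
  exact ⟨fun ⟨l, hl⟩ => ⟨ObjectProperty.homMk l, ObjectProperty.hom_ext _ hl⟩,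
    fun ⟨l, hl⟩ => ⟨l.hom, congrArg (·.hom) hl⟩⟩

include hT in
lemma toStableHom_surjective (N : (𝓔.preimage T).FullSubcategory) :
    Function.Surjective (R.toStableHom N) := fun x => by
  obtain ⟨f, hf⟩ := R.conflation₂.exists_connecting_comp_eq R.isConnecting₂
    (extZero_of_isClusterTilting hT R.M₂.property N.property) x
  exact ⟨ObjectProperty.homMk f, hf⟩

/-- The linear form on `Hom(M₃, M₀)` defined by the traces of the stable category. -/
noncomputable def preTrace : (R.M₃ ⟶ R.M₀) →ₗ[k] k :=
  tr _ ∘ₗ Linear.rightComp k _ (𝓔.suspension.map (toSuspension R.c₁)) ∘ₗ R.toStableHom R.M₀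

lemma preTrace_comp {N : (𝓔.preimage T).FullSubcategory} (f : R.M₃ ⟶ N) (b : N ⟶ R.M₀) :
    R.preTrace tr (f ≫ b) = tr _ (R.toStableHom N f ≫
      𝓔.suspension.map (𝓔.toStable.map b.hom ≫ toSuspension R.c₁)) := by
  simp only [preTrace, LinearMap.comp_apply, Linear.rightComp_apply, toStableHom_apply,
    ObjectProperty.FullSubcategory.comp_hom, Functor.map_comp, Category.assoc]

/-- A map M₃ → M₀ that becomes zero in Z factors through p, and p is killed by the connecting
morphism c₁. -/
lemma exists_trace : ∃ τ : ((LinMod.yoneda k).obj R.M₃ ⟶ Z) →ₗ[k] k,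
    ∀ g : R.M₃ ⟶ R.M₀,
      τ ((LinMod.yoneda k).map g ≫ LinMod.ofElement R.w) = R.preTrace tr g :=
  exists_dual_comp_eq (Linear.rightComp k _ (LinMod.ofElement R.w) ∘ₗ
    (LinMod.yoneda k).mapLinearMap k) (R.preTrace tr) fun g hg => by
      obtain ⟨l, rfl⟩ := (R.isPresentation.comp_eq_zero_iff g).1 hg
      rw [preTrace_comp, (R.conflation₁.map_comp_connecting_eq_zero_iff R.isConnecting₁ _).2
        ⟨𝟙 _, Category.id_comp _⟩, Functor.map_zero, comp_zero, map_zero]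

variable [HasDerivedCategory.{w} (LinMod k (𝓔.preimage T).FullSubcategory)]

/-- A linear form on `Hom(Z, Z[3])` is compatible with the traces of the stable category. -/
def IsTrace (t : ((singleFunctor (LinMod k (𝓔.preimage T).FullSubcategory) 0).obj Z ⟶
    ((singleFunctor _ 0).obj Z)⟦(3 : ℤ)⟧) →ₗ[k] k) : Prop :=
  ∀ g : R.M₃ ⟶ R.M₀, t ((R.toResolution hT).toShiftedHom k Z
    ((LinMod.yoneda k).map g ≫ LinMod.ofElement R.w)) = R.preTrace tr g

variable {tr}

/-- At N^[3] the pairing becomes the stable pairing of C(K, SN) with C(SN, S²K): the former is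
Ext³(Z, N^), the latter is C(N, SK) ≅ Z(N) since the suspension is fully faithful. -/
lemma exists_isTrace_isPerfectAt : ∃ t, R.IsTrace hT tr t ∧
    ((∀ X Y, IsPerfectAt (tr X) Y) → ∀ (N : (𝓔.preimage T).FullSubcategory) (n : ℤ),
      IsPerfectAt t (((singleFunctor _ 0).obj ((LinMod.yoneda k).obj N))⟦n⟧)) := by
  obtain ⟨τ, hτ⟩ := R.exists_trace tr
  -- The form descends to Ext³ because maps extending over M₂ factor through m, and c₂ followed by
  -- the suspension of m is zero.
  obtain ⟨t, ht⟩ := (R.toResolution hT).exists_dual_toShiftedHom τ fun g => by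
    obtain ⟨η, rfl⟩ := R.isPresentation.exists_comp_eq g
    rw [toResolution_d₃, ← Category.assoc, ← Functor.map_comp, hτ, preTrace_comp,
      (R.toStableHom_eq_zero_iff R.m).2 ⟨𝟙 _, Category.comp_id _⟩, zero_comp, map_zero]
  refine ⟨t, fun g => by rw [ht, hτ], fun htr N n => ?_⟩
  have key (β : N ⟶ R.M₀) (f : R.M₃ ⟶ N) : τ ((LinMod.yoneda k).map f ≫
      (LinMod.yoneda k).map β ≫ LinMod.ofElement R.w) = tr _ (R.toStableHom N f ≫
      𝓔.suspension.map (𝓔.toStable.map β.hom ≫ toSuspension R.c₁)) := by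
    rw [← Category.assoc, ← Functor.map_comp, hτ, preTrace_comp]
  refine (R.toResolution hT).isPerfectAt_shift R.eq_zero_of_hom_yoneda
    (R.exists_eq_d₁_comp hT) (R.exists_eq_d₂_comp hT) τ t ht (fun b hb => ?_)
    (fun φ hφ => ?_) n
  · obtain ⟨β, rfl⟩ := R.isPresentation.exists_comp_eq b
    have h0 := (htr _ _).eq_zero
      (𝓔.suspension.map (𝓔.toStable.map β.hom ≫ toSuspension R.c₁)) fun a => by
        obtain ⟨f, rfl⟩ := R.toStableHom_surjective hT N a
        rw [← key, hb]
    rw [← 𝓔.suspension.map_zero] at h0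
    obtain ⟨l, hl⟩ := (R.conflation₁.map_comp_connecting_eq_zero_iff R.isConnecting₁ _).1
      (𝓔.suspension.map_injective h0)
    exact (R.isPresentation.comp_eq_zero_iff β).2
      ⟨ObjectProperty.homMk l, ObjectProperty.hom_ext _ hl⟩
  -- Read φ as a form on C(K, SN). Duality represents it by a map SN → S²K, which desuspends to N →
  -- SK and then has the form β followed by c₁, as C(N, SM₁) = 0.
  · obtain ⟨ψ, hψ⟩ := exists_dual_comp_eq (R.toStableHom N)
      (φ ∘ₗ (LinMod.yoneda k).mapLinearMap k) fun f hf => by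
        obtain ⟨g, rfl⟩ := (R.toStableHom_eq_zero_iff f).1 hf
        have := hφ ((LinMod.yoneda k).map g)
        rw [toResolution_d₃, ← Functor.map_comp] at this
        exact this
    obtain ⟨y, hy⟩ := (htr _ _).exists_eq ψ
    obtain ⟨y, rfl⟩ := 𝓔.suspension.map_surjective y
    obtain ⟨β, rfl⟩ := R.conflation₁.exists_comp_connecting_eq R.isConnecting₁
      (extZero_of_isClusterTilting hT N.property R.M₁.property) y
    refine ⟨(LinMod.yoneda k).map (ObjectProperty.homMk β) ≫ LinMod.ofElement R.w, fun f => ?_⟩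
    obtain ⟨f, rfl⟩ := (LinMod.yoneda k).map_surjective f
    rw [key]
    exact (hy _).trans (hψ f)

variable {R}
variable {Z' : LinMod k (𝓔.preimage T).FullSubcategory} {R' : StableResolution Z'}

/-- Lift z to maps ν₀, …, ν₃ of resolutions, with κ : K → K'. If g : M₃' → M₀ represents a, then μ ≫
g represents z ≫ a and g ≫ ν₀ represents a ≫ z[3]. Naturality of c₂ and c₁ moves μ and ν₀ to κ at
the two ends, where stable cyclicity exchanges them. -/
lemma IsTrace.cyclic (hcyc : ∀ {X Y} (a : X ⟶ Y) (b : Y ⟶ 𝓔.suspension.obj (𝓔.suspension.obj X)),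
      tr Y (b ≫ 𝓔.suspension.map (𝓔.suspension.map a)) = tr X (a ≫ b))
    {t : ((singleFunctor (LinMod k (𝓔.preimage T).FullSubcategory) 0).obj Z ⟶
      ((singleFunctor _ 0).obj Z)⟦(3 : ℤ)⟧) →ₗ[k] k} (ht : R.IsTrace hT tr t)
    {t' : ((singleFunctor (LinMod k (𝓔.preimage T).FullSubcategory) 0).obj Z' ⟶
      ((singleFunctor _ 0).obj Z')⟦(3 : ℤ)⟧) →ₗ[k] k} (ht' : R'.IsTrace hT tr t')
    (z : Z ⟶ Z') (a : (singleFunctor _ 0).obj Z' ⟶ ((singleFunctor _ 0).obj Z)⟦(3 : ℤ)⟧) :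
    t' (a ≫ ((singleFunctor _ 0).map z)⟦(3 : ℤ)⟧') = t ((singleFunctor _ 0).map z ≫ a) := by
  obtain ⟨ν₀, h₀⟩ := R'.isPresentation.exists_comp_eq (LinMod.ofElement R.w ≫ z)
  obtain ⟨ν₁, h₁⟩ := (R'.isPresentation.comp_eq_zero_iff (R.p ≫ ν₀)).1 (by
    rw [Functor.map_comp, Category.assoc, h₀, ← Category.assoc, R.isPresentation.zero,
      zero_comp])
  replace h₁' : ν₁.hom ≫ R'.p.hom = R.p.hom ≫ ν₀.hom := congrArg (·.hom) h₁
  obtain ⟨κ, hκ⟩ := R'.conflation₁.exists_factor (R.i ≫ ν₁.hom) (by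
    rw [Category.assoc, h₁', ← Category.assoc, R.conflation₁.zero, zero_comp])
  obtain ⟨ν₂, hν₂⟩ := exists_lift_of_preimage hT R'.conflation₂ R'.M₃.property R.M₂.property
    (R.q ≫ κ)
  obtain ⟨ν₃, hν₃⟩ := R'.conflation₂.exists_factor (R.m.hom ≫ ν₂) (by
    rw [Category.assoc, hν₂, ← Category.assoc, R.conflation₂.zero, zero_comp])
  let μ : R.M₃ ⟶ R'.M₃ := ObjectProperty.homMk ν₃
  let μ₂ : R.M₂ ⟶ R'.M₂ := ObjectProperty.homMk ν₂
  have hnat := (R.toResolution hT).connecting_naturality (R'.toResolution hT)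
    ((LinMod.yoneda k).map μ) ((LinMod.yoneda k).map μ₂) ((LinMod.yoneda k).map ν₁)
    ((LinMod.yoneda k).map ν₀) z
    (by
      rw [toResolution_d₃, toResolution_d₃, ← Functor.map_comp, ← Functor.map_comp]
      exact congrArg _ (ObjectProperty.hom_ext _ hν₃.symm))
    (by
      rw [toResolution_d₂, toResolution_d₂, ← Functor.map_comp, ← Functor.map_comp]
      refine congrArg _ (ObjectProperty.hom_ext _ ?_)
      change (R.q ≫ R.i) ≫ ν₁.hom = ν₂ ≫ R'.q ≫ R'.i
      rw [← Category.assoc ν₂, hν₂, Category.assoc, Category.assoc, hκ])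
    (by
      rw [toResolution_d₁, toResolution_d₁, ← Functor.map_comp, ← Functor.map_comp, h₁])
    h₀.symm
  have n₁ := R.conflation₁.connecting_naturality R.isConnecting₁ R'.isConnecting₁ hκ.symm h₁'.symm
  have n₂ := R.conflation₂.connecting_naturality R.isConnecting₂ R'.isConnecting₂ hν₃.symm
    hν₂.symm
  replace n₂ : toSuspension R.c₂ ≫ 𝓔.suspension.map (𝓔.toStable.map μ.hom) =
    𝓔.toStable.map κ ≫ toSuspension R'.c₂ := n₂
  obtain ⟨b, rfl⟩ := (R'.toResolution hT).toShiftedHom_surjective (k := k) _ a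
  obtain ⟨g, rfl⟩ := R.isPresentation.exists_comp_eq b
  have e₁ : (singleFunctor _ 0).map z ≫ (R'.toResolution hT).toShiftedHom k Z
      ((LinMod.yoneda k).map g ≫ LinMod.ofElement R.w) = (R.toResolution hT).toShiftedHom k Z
      ((LinMod.yoneda k).map (μ ≫ g) ≫ LinMod.ofElement R.w) := by
    rw [LengthThreeResolution.toShiftedHom_apply, ← Category.assoc, ← hnat,
      LengthThreeResolution.toShiftedHom_apply, Category.assoc, ← Functor.map_comp,
      ← Functor.map_comp, Functor.map_comp (LinMod.yoneda k), Category.assoc]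
  have e₂ : (R'.toResolution hT).toShiftedHom k Z ((LinMod.yoneda k).map g ≫
      LinMod.ofElement R.w) ≫ ((singleFunctor _ 0).map z)⟦(3 : ℤ)⟧' =
      (R'.toResolution hT).toShiftedHom k Z'
        ((LinMod.yoneda k).map (g ≫ ν₀) ≫ LinMod.ofElement R'.w) := by
    rw [← LengthThreeResolution.toShiftedHom_comp, Category.assoc, ← h₀, Functor.map_comp,
      Category.assoc]
  rw [e₁, e₂, ht, ht', preTrace_comp, preTrace_comp, ← n₁, Functor.map_comp, ← Category.assoc,
    hcyc, toStableHom_apply, toStableHom_apply, ← Category.assoc, n₂]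
  simp only [Functor.map_comp, Category.assoc]

end Trace

end StableResolution

end Resolutions

end ExactStructure

/-! ### Perfect complexes of modules -/

namespace LinMod

open DerivedCategory

variable {k : Type t} [Field k] {A : Type u} [Category.{v} A] [Preadditive A] [Linear k A]
  [HasDerivedCategory.{w} (LinMod k A)]

instance : (isPerfect k A).IsClosedUnderIsomorphisms :=
  inferInstanceAs (triangulatedHull _).IsClosedUnderIsomorphisms

lemma isPerfect_yoneda (M : A) :
    isPerfect k A ((singleFunctor (LinMod k A) 0).obj ((LinMod.yoneda k).obj M)) :=
  fun _ _ _ hQ => hQ _ ⟨_, inferInstance, ⟨M, 𝟙 _, inferInstance⟩, ⟨Iso.refl _⟩⟩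

lemma isPerfectAt_of_isPerfect {X X' : DerivedCategory (LinMod k A)} (t : (X ⟶ X') →ₗ[k] k)
    (ht : ∀ (M : A) (n : ℤ),
      IsPerfectAt t (((singleFunctor (LinMod k A) 0).obj ((LinMod.yoneda k).obj M))⟦n⟧))
    {Y : DerivedCategory (LinMod k A)} (hY : isPerfect k A Y) : IsPerfectAt t Y := by
  refine isPerfectAt_of_triangulatedHull _ ?_ hY
  rintro Y ⟨Z, hZ, ⟨M, p, hp⟩, ⟨e⟩⟩ n
  -- A projective quotient of a representable splits off.
  have r : Retract Z ((LinMod.yoneda k).obj M) :=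
    ⟨Projective.factorThru (𝟙 Z) p, p, Projective.factorThru_comp _ _⟩
  exact (ht M n).of_retract (((Retract.ofIso e).trans (r.map (singleFunctor _ 0))).map
    (shiftFunctor _ n))

end LinMod

theorem proposition4p1 {k : Type t} [Field k] {E : Type u} [Category.{v} E] [Preadditive E]
    [Linear k E] [HasFiniteBiproducts E] [IsIdempotentComplete E]
    (𝓔 : ExactStructure E) [𝓔.IsFrobenius]
    (hfin : ∀ X Y : 𝓔.StableCategory, FiniteDimensional k (X ⟶ Y))
    (hCY : IsTwoCalabiYau k 𝓔.suspension)
    (T : ObjectProperty 𝓔.StableCategory) (hT : IsClusterTilting 𝓔.suspension T)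
    [HasDerivedCategory.{w} (LinMod k (𝓔.preimage T).FullSubcategory)] :
    -- conflations that resolve the objects of `E`
    ((∀ X : E, ∃ (M₁ M₀ : E) (i : M₁ ⟶ M₀) (p : M₀ ⟶ X),
        𝓔.preimage T M₁ ∧ 𝓔.preimage T M₀ ∧ 𝓔.IsConflation i p) ∧
      (∀ (X M₁ M₀ : E) (i : M₁ ⟶ M₀) (p : M₀ ⟶ X),
        𝓔.preimage T M₁ → 𝓔.preimage T M₀ → 𝓔.IsConflation i p →
          IsRightApproximation (𝓔.preimage T) p)) ∧
    -- finitely presented `M`-modules that vanish on the projectives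
    (∀ Z : LinMod k (𝓔.preimage T).FullSubcategory,
      LinMod.isFinitelyPresented k (𝓔.preimage T).FullSubcategory Z →
        (((∀ P : (𝓔.preimage T).FullSubcategory, 𝓔.IsProjective P.obj →
            IsZero (Z.obj.obj (Opposite.op P))) ↔
          ∃ (K : E) (M₁ M₀ : (𝓔.preimage T).FullSubcategory) (i : K ⟶ M₁.obj) (p : M₁ ⟶ M₀),
            𝓔.IsConflation i p.hom ∧ Nonempty (Z ≅ cokernel ((LinMod.yoneda k).map p))) ∧
        (∀ (K : E) (M₁ M₀ : (𝓔.preimage T).FullSubcategory) (i : K ⟶ M₁.obj) (p : M₁ ⟶ M₀),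
          𝓔.IsConflation i p.hom → Nonempty (Z ≅ cokernel ((LinMod.yoneda k).map p)) →
            Nonempty (Z.obj ≅ (𝓔.preimage T).ι.op ⋙ 𝓔.ext1 k K)))) ∧
    -- perfection and duality for finitely presented modules over the stable category of `M`
    (∃ h : ∀ Z : (LinMod.isFinitelyPresented k T.FullSubcategory).FullSubcategory,
        isPerfect k (𝓔.preimage T).FullSubcategory ((𝓔.stableModuleToDerived k T).obj Z),
      Nonempty (NaturalDuality k
        ((isPerfect k _).lift (𝓔.stableModuleToDerived k T) h)
        ((isPerfect k _).lift (𝓔.stableModuleToDerived k T) h ⋙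
          shiftFunctor (Per k (𝓔.preimage T).FullSubcategory) (3 : ℤ)))) := by
  refine ⟨⟨ExactStructure.exists_conflation_of_isClusterTilting hT, fun X M₁ M₀ i p h₁ h₀ h =>
    ⟨h₀, fun N f hN => ExactStructure.exists_lift_of_preimage hT h h₁ hN f⟩⟩,
    fun Z hZ => ⟨ExactStructure.isZero_iff_exists_conflation hT hZ, fun K M₁ M₀ i p h hZ' =>
      ExactStructure.nonempty_iso_ext1 hT h hZ'⟩, ?_⟩
  let R (Z : (LinMod.isFinitelyPresented k T.FullSubcategory).FullSubcategory) :
      ExactStructure.StableResolution ((LinMod.restrict k (𝓔.projection T)).obj Z.obj) :=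
    (ExactStructure.nonempty_stableResolution hT Z.property).some
  have hR (Z : (LinMod.isFinitelyPresented k T.FullSubcategory).FullSubcategory) :
      isPerfect k (𝓔.preimage T).FullSubcategory ((𝓔.stableModuleToDerived k T).obj Z) :=
    ((R Z).toResolution hT).prop_singleFunctor_obj _ (LinMod.isPerfect_yoneda _)
      (LinMod.isPerfect_yoneda _) (LinMod.isPerfect_yoneda _) (LinMod.isPerfect_yoneda _)
  obtain ⟨tr, htr, hcyc⟩ := hCY.exists_trace
  -- Resolutions are chosen independently for each Z; cyclicity compares arbitrary ones, so no
  -- compatibility of the choices is needed.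
  choose t ht ht' using fun Z => (R Z).exists_isTrace_isPerfectAt hT (tr := tr)
  exact ⟨hR, nonempty_naturalDuality_of_trace _ _ hR 3 t
    (fun Z Y hY => LinMod.isPerfectAt_of_isPerfect _ (ht' Z htr) hY)
    fun z a => ExactStructure.StableResolution.IsTrace.cyclic hT hcyc (ht _) (ht _)
      ((LinMod.restrict k (𝓔.projection T)).map z.hom) a⟩
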